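/- \textbf{Setting.} Let $\mathbb K$ be a field of characteristic $0$ (for instance $\mathbb R$ or $\mathbb C$), $\mathfrak B$ a unital $\mathbb K$-algebra, and $(\mathcal A,\mathfrak B,\varphi)$ an algebraic probability space: $\mathcal A$ is a unital $\mathbb K$-algebra containing $\mathfrak B$ as a unital subalgebra, and $\varphi:\mathcal A\to\mathfrak B$ is a $\mathbb K$-linear conditional expectation, i.e. $\varphi(b_1xb_2)=b_1\varphi(x)b_2$ and $\varphi(b)=b$ for $b,b_1,b_2\in\mathfrak B$, $x\in\mathcal A$. Let $\mathrm{Mul}^r[[\mathfrak B]]$ be the set of all families $F=(F_{i_1,\dots,i_n})_{n\ge 0,\ i_1,\dots,i_n\in\{1,\dots,r\}}$ of $\mathbb K$-multilinear maps $F_{i_1,\dots,i_n}:\mathfrak B^n\to\mathfrak B$ (for $n=0$, a constant $F_\emptyset\in\mathfrak B$). \textbf{Operations.} For $V=\{v_1<\dots<v_p\}\subset\{1,\dots,n\}$ put $i(V)=(i_{v_1},\dots,i_{v_p})$, $b_V=(b_{v_1},\dots,b_{v_p})$, and, with $v_0=0$ and $v_{p+1}=n+1$, $V_j=\{v_{j-1}+1,\dots,v_j-1\}$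 for $1\le j\le p+1$. For $F,G\in \mathrm{Mul}^r[[\mathfrak B]]$ define $$(F\odot G)_{i_1,\dots,i_n}(b_1,\dots,b_n)=\sum_{V\subset\{1,\dots,n\}}F_{i(V)}\big(G_{i(V_1)}(b_{V_1})b_{v_1},\dots,G_{i(V_p)}(b_{V_p})b_{v_p}\big)\,G_{i(V_{p+1})}(b_{V_{p+1}}),$$ $$(F\star G)_{i_1,\dots,i_n}(b_1,\dots,b_n)=\sum_{V=\{k,k+1,\dots,m\}}F_{i(V^c)}\big(b_1,\dots,b_{k-1},G_{i(V)}(b_V)b_{m+1},b_{m+2},\dots,b_n\big)\qquad(n\ge1),$$ where the second sum is over all $1\le k\le m\le n$, the summand with $m=n$ is $F_{i(V^c)}(b_{V^c})\,G_{i(V)}(b_V)$, components over empty index sets are the constants $F_\emptyset,G_\emptyset$, and $(F\star G)_\emptyset=F_\emptyset G_\emptyset$. \textbf{Dot operation.} A family of (not necessarily unital) subalgebras $(\mathcal A_\lambda)_{\lambda\in\Lambda}$ of an algebraic probability space, indexed by a linearly ordered set, is monotone independent over $\mathfrak B$ if $\varphi(x_1\cdots x_n)=\varphi(x_1\cdots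 x_{p-1}\varphi(x_p)x_{p+1}\cdots x_n)$ whenever $x_k\in\mathcal A_{\lambda_k}$ for all $k$ and $\lambda_p$ is strictly larger than $\lambda_{p-1}$ and $\lambda_{p+1}$ (one condition being dropped if $p=1$ or $p=n$). Let $x\mapsto x^{(j)}$, $j=1,2,\dots$, be multiplicative, $\mathbb K$-linear and $\mathfrak B$-bilinear (not necessarily unital) maps from $\mathcal A$ into an algebraic probability space $(\widetilde{\mathcal A},\mathfrak B,\widetilde\varphi)$ such that $\widetilde\varphi(x_1^{(j)}\cdots x_n^{(j)})=\varphi(x_1\cdots x_n)$ for all $j,n\ge1$, and such that the images $\mathcal A^{(1)},\mathcal A^{(2)},\dots$ are monotone independent over $\mathfrak B$. For $N\in\mathbb N=\{0,1,2,\dots\}$ put $N.x=x^{(1)}+\dots+x^{(N)}$. Let $X=(X_1,\dots,X_r)\in\mathcal A^r$, and let $\mu^{N.X}\in \mathrm{Mul}^r[[\mathfrak B]]$ be given by $\mu^{N.X}_{i_1,\dots,i_n}(b_1,\dots,b_n)=\widetilde\varphi\big(b_1(N.X_{i_1})b_2(N.X_{i_2})\cdots b_n(N.X_{i_n})\big)$,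 $\mu^{N.X}_\emptyset=1$. \textbf{Statement.} (1) For all $n$ and $x_1,\dots,x_n\in\mathcal A$, $N\mapsto\widetilde\varphi\big((N.x_1)\cdots(N.x_n)\big)$ is a polynomial in $N$ with coefficients in $\mathfrak B$, and its coefficient of $N$, denoted $K_n(x_1,\dots,x_n)$ (the $n$th joint monotone cumulant), is uniquely determined and is $\mathbb K$-multilinear in $(x_1,\dots,x_n)$. Consequently $\kappa^X_{i_1,\dots,i_n}(b_1,\dots,b_n):=K_n(b_1X_{i_1},\dots,b_nX_{i_n})$ for $n\ge1$, $\kappa^X_\emptyset:=0$, defines $\kappa^X\in\mathrm{Mul}^r[[\mathfrak B]]$. (2) There is exactly one family $(\mu^{t.X})_{t\in\mathbb K}$ in $\mathrm{Mul}^r[[\mathfrak B]]$ each of whose components $\mu^{t.X}_{i_1,\dots,i_n}$ is a polynomial in $t$ (with multilinear maps as coefficients) and which for $t=N\in\mathbb N$ is the family $\mu^{N.X}$ above. (3) For all $t\in\mathbb K$, $$\frac{d}{dt}\mu^{t.X}=\kappa^X\odot\mu^{t.X}=\mu^{t.X}\star\kappa^X,$$ where $\frac{d}{dt}$ is the componentwise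 derivative of polynomials in $t$ (for $\mathbb K=\mathbb R$, the usual derivative). -/

import Mathlib

/-!
# Operator-valued monotone probability: moments, cumulants, dot operation

Throughout, `𝕜` is the ground field and `𝔅` a unital (not necessarily commutative) `𝕜`-algebra.
-/

noncomputable section

namespace OpMonotone

/-! ## Polynomial functions with values in a vector space -/

section PolynomialFunctions

variable {𝕜 M : Type*} [Field 𝕜] [AddCommGroup M] [Module 𝕜 M]

/-- The value at `t` of the polynomial `∑ₖ tᵏ cₖ` with coefficients `cₖ` in a vector space. -/
def polyEval (c : ℕ →₀ M) (t : 𝕜) : M := c.sum fun k m => t ^ k • m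

/-- The value at `t` of the derivative `∑ₖ k tᵏ⁻¹ cₖ` of the polynomial `∑ₖ tᵏ cₖ`. -/
def polyDerivEval (c : ℕ →₀ M) (t : 𝕜) : M := c.sum fun k m => ((k : 𝕜) * t ^ (k - 1)) • m

/-- `f` is a polynomial function of `t`. -/
def IsPolyFun (f : 𝕜 → M) : Prop := ∃ c : ℕ →₀ M, ∀ t, f t = polyEval c t

/-- `f` is a polynomial function of `t`, and `f'` is its derivative with respect to `t`. -/
def HasPolyDeriv (f f' : 𝕜 → M) : Prop :=
  ∃ c : ℕ →₀ M, (∀ t, f t = polyEval c t) ∧ ∀ t, f' t = polyDerivEval c t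

end PolynomialFunctions

/-! ## Families of multilinear functionals -/

/-- The families `F = (F_{i₁,…,iₙ})`, indexed by the finite words `(i₁,…,iₙ)`, `n ≥ 0`, in the
letters `1,…,r`, where `F_{i₁,…,iₙ}` is a multilinear map `𝔅ⁿ → 𝔅`; for `n = 0` it is a constant. -/
abbrev MulSeries (𝕜 𝔅 : Type*) [Field 𝕜] [Ring 𝔅] [Algebra 𝕜 𝔅] (r : ℕ) : Type _ :=
  (n : ℕ) → (Fin n → Fin r) → MultilinearMap 𝕜 (fun _ : Fin n => 𝔅) 𝔅

section Operations

variable {𝕜 𝔅 : Type*} [Field 𝕜] [Ring 𝔅] [Algebra 𝕜 𝔅] {r n : ℕ}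

/-- `F_{i(W)}(b_W)`: the component of `F` on the letters and arguments with positions in `W`,
in increasing order. -/
def onBlock (F : MulSeries 𝕜 𝔅 r) (i : Fin n → Fin r) (W : Finset (Fin n)) (b : Fin n → 𝔅) : 𝔅 :=
  F W.card (fun a => i (W.orderEmbOfFin rfl a)) (fun a => b (W.orderEmbOfFin rfl a))

/-- The interpolation blocks of `V = {v₁ < ⋯ < vₚ}`, numbered from `0` to `p`: block `j` consists
of the positions that lie after the first `j` elements of `V` and before all the others. -/
def interpBlock (V : Finset (Fin n)) (j : Fin (V.card + 1)) : Finset (Fin n) :=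
  Finset.univ.filter fun x =>
    (∀ a : Fin V.card, a.castSucc < j → V.orderEmbOfFin rfl a < x) ∧
    (∀ a : Fin V.card, j ≤ a.castSucc → x < V.orderEmbOfFin rfl a)

/-- The summand
`F_{i(V)}(G_{i(V₁)}(b_{V₁}) b_{v₁}, …, G_{i(Vₚ)}(b_{Vₚ}) b_{vₚ}) G_{i(Vₚ₊₁)}(b_{Vₚ₊₁})`. -/
def compTerm (F G : MulSeries 𝕜 𝔅 r) (i : Fin n → Fin r) (V : Finset (Fin n)) (b : Fin n → 𝔅) :
    𝔅 :=
  F V.card (fun a => i (V.orderEmbOfFin rfl a))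
      (fun a => onBlock G i (interpBlock V a.castSucc) b * b (V.orderEmbOfFin rfl a)) *
    onBlock G i (interpBlock V (Fin.last _)) b

/-- The summand of the insertion product for the interval block `V = {k,…,m}`:
`F_{i(Vᶜ)}(b₁, …, bₖ₋₁, G_{i(V)}(b_V) bₘ₊₁, …, bₙ)`, and `F_{i(Vᶜ)}(b_{Vᶜ}) G_{i(V)}(b_V)` if `m` is
the last position. -/
def insertTerm (F G : MulSeries 𝕜 𝔅 r) (i : Fin n → Fin r) (k m : Fin n) (b : Fin n → 𝔅) : 𝔅 :=
  F (Finset.Icc k m)ᶜ.card (fun a => i ((Finset.Icc k m)ᶜ.orderEmbOfFin rfl a))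
      (fun a =>
        if ((Finset.Icc k m)ᶜ.orderEmbOfFin rfl a : ℕ) = m + 1
        then onBlock G i (Finset.Icc k m) b * b ((Finset.Icc k m)ᶜ.orderEmbOfFin rfl a)
        else b ((Finset.Icc k m)ᶜ.orderEmbOfFin rfl a)) *
    (if (m : ℕ) + 1 = n then onBlock G i (Finset.Icc k m) b else 1)

/-! ### Multilinearity of the summands -/

/-- A map is linear in each argument if all its one-variable slices are linear maps. -/
def mkOfSlices (f : (Fin n → 𝔅) → 𝔅)
    (h : ∀ (b : Fin n → 𝔅) (x : Fin n), ∃ L : 𝔅 →ₗ[𝕜] 𝔅, ∀ c, f (Function.update b x c) = L c) :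
    MultilinearMap 𝕜 (fun _ : Fin n => 𝔅) 𝔅 :=
  MultilinearMap.mk' f
    (fun b x c c' => by obtain ⟨L, hL⟩ := h b x; simp only [hL, map_add])
    (fun b x s c => by obtain ⟨L, hL⟩ := h b x; simp only [hL, map_smul])

theorem onBlock_update_of_notMem (G : MulSeries 𝕜 𝔅 r) (i : Fin n → Fin r) {W : Finset (Fin n)}
    {x : Fin n} (hx : x ∉ W) (b : Fin n → 𝔅) (c : 𝔅) :
    onBlock G i W (Function.update b x c) = onBlock G i W b := by
  unfold onBlock
  congr 1
  funext a
  rw [Function.update_of_ne]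
  rintro rfl
  exact hx (Finset.orderEmbOfFin_mem W rfl a)

theorem onBlock_slice (G : MulSeries 𝕜 𝔅 r) (i : Fin n → Fin r) {W : Finset (Fin n)}
    {x : Fin n} (hx : x ∈ W) (b : Fin n → 𝔅) :
    ∃ L : 𝔅 →ₗ[𝕜] 𝔅, ∀ c, onBlock G i W (Function.update b x c) = L c := by
  obtain ⟨a, ha⟩ : x ∈ Set.range (W.orderEmbOfFin rfl) := by
    rw [Finset.range_orderEmbOfFin]; exact hx
  subst ha
  refine ⟨(G W.card (fun a => i (W.orderEmbOfFin rfl a))).toLinearMap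
    (fun a => b (W.orderEmbOfFin rfl a)) a, fun c => ?_⟩
  unfold onBlock
  rw [MultilinearMap.toLinearMap_apply]
  congr 1
  exact Function.update_comp_eq_of_injective b (W.orderEmbOfFin rfl).injective a c

/-- If exactly one argument of `F` depends on `c`, and that linearly, the value is linear in `c`. -/
theorem slice_arg {p : ℕ} (F : MultilinearMap 𝕜 (fun _ : Fin p => 𝔅) 𝔅) (g : 𝔅 → Fin p → 𝔅)
    (a : Fin p) (L : 𝔅 →ₗ[𝕜] 𝔅) (ha : ∀ c, g c a = L c) (hne : ∀ a', a' ≠ a → ∀ c, g c a' = g 0 a') :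
    ∃ L' : 𝔅 →ₗ[𝕜] 𝔅, ∀ c, F (g c) = L' c := by
  refine ⟨(F.toLinearMap (g 0) a).comp L, fun c => ?_⟩
  rw [LinearMap.comp_apply, MultilinearMap.toLinearMap_apply]
  congr 1
  funext a'
  by_cases h : a' = a
  · subst h; simp [ha]
  · rw [Function.update_of_ne h, hne a' h]

theorem interpBlock_disjoint {V : Finset (Fin n)} {j j' : Fin (V.card + 1)} {x : Fin n}
    (hx : x ∈ interpBlock V j) (hx' : x ∈ interpBlock V j') : j = j' := by
  simp only [interpBlock, Finset.mem_filter, Finset.mem_univ, true_and] at hx hx'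
  by_contra hne
  rcases lt_or_gt_of_ne hne with h | h
  · have hj : (j : ℕ) < V.card := lt_of_lt_of_le h (Nat.lt_succ_iff.mp j'.2)
    exact lt_asymm (hx.2 ⟨j, hj⟩ le_rfl) (hx'.1 ⟨j, hj⟩ h)
  · have hj : (j' : ℕ) < V.card := lt_of_lt_of_le h (Nat.lt_succ_iff.mp j.2)
    exact lt_asymm (hx'.2 ⟨j', hj⟩ le_rfl) (hx.1 ⟨j', hj⟩ h)

theorem notMem_interpBlock {V : Finset (Fin n)} {x : Fin n} (hx : x ∈ V) (j : Fin (V.card + 1)) :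
    x ∉ interpBlock V j := by
  obtain ⟨a, ha⟩ : x ∈ Set.range (V.orderEmbOfFin rfl) := by
    rw [Finset.range_orderEmbOfFin]; exact hx
  subst ha
  simp only [interpBlock, Finset.mem_filter, Finset.mem_univ, true_and]
  rintro ⟨h1, h2⟩
  rcases lt_or_ge a.castSucc j with h | h
  · exact lt_irrefl _ (h1 a h)
  · exact lt_irrefl _ (h2 a h)

theorem exists_mem_interpBlock {V : Finset (Fin n)} {x : Fin n} (hx : x ∉ V) :
    ∃ j, x ∈ interpBlock V j := by
  have hne : ∀ a, V.orderEmbOfFin rfl a ≠ x := fun a h =>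
    hx (h ▸ Finset.orderEmbOfFin_mem V rfl a)
  by_cases h : ∃ a : Fin V.card, x < V.orderEmbOfFin rfl a
  · refine ⟨(Fin.find _ h).castSucc, ?_⟩
    simp only [interpBlock, Finset.mem_filter, Finset.mem_univ, true_and, Fin.castSucc_lt_castSucc_iff,
      Fin.castSucc_le_castSucc_iff]
    refine ⟨fun a ha => ?_, fun a ha => ?_⟩
    · exact lt_of_le_of_ne (not_lt.mp (Fin.find_min h ha)) (hne a)
    · exact lt_of_lt_of_le (Fin.find_spec h) ((V.orderEmbOfFin rfl).monotone ha)
  · push Not at h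
    refine ⟨Fin.last _, ?_⟩
    simp only [interpBlock, Finset.mem_filter, Finset.mem_univ, true_and]
    exact ⟨fun a _ => lt_of_le_of_ne (h a) (hne a),
      fun a ha => absurd ha (not_le.mpr (Fin.castSucc_lt_last a))⟩

theorem compTerm_slice (F G : MulSeries 𝕜 𝔅 r) (i : Fin n → Fin r) (V : Finset (Fin n))
    (b : Fin n → 𝔅) (x : Fin n) :
    ∃ L : 𝔅 →ₗ[𝕜] 𝔅, ∀ c, compTerm F G i V (Function.update b x c) = L c := by
  by_cases hV : x ∈ V
  · obtain ⟨a, ha⟩ : x ∈ Set.range (V.orderEmbOfFin rfl) := by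
      rw [Finset.range_orderEmbOfFin]; exact hV
    obtain ⟨L, hL⟩ := slice_arg (F V.card fun a => i (V.orderEmbOfFin rfl a))
      (fun c a => onBlock G i (interpBlock V a.castSucc) b *
        Function.update b x c (V.orderEmbOfFin rfl a)) a
      (LinearMap.mulLeft 𝕜 (onBlock G i (interpBlock V a.castSucc) b))
      (fun c => by simp [ha])
      (fun a' ha' c => by
        have : V.orderEmbOfFin rfl a' ≠ x := fun h =>
          ha' ((V.orderEmbOfFin rfl).injective (h.trans ha.symm))
        simp only [Function.update_of_ne this])
    refine ⟨(LinearMap.mulRight 𝕜 (onBlock G i (interpBlock V (Fin.last _)) b)).comp L,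
      fun c => ?_⟩
    unfold compTerm
    simp only [onBlock_update_of_notMem G i (notMem_interpBlock hV _)]
    rw [hL]
    rfl
  · have hne : ∀ a, V.orderEmbOfFin rfl a ≠ x := fun a h =>
      hV (h ▸ Finset.orderEmbOfFin_mem V rfl a)
    by_cases hlast : x ∈ interpBlock V (Fin.last _)
    · obtain ⟨L, hL⟩ := onBlock_slice G i hlast b
      refine ⟨(LinearMap.mulLeft 𝕜 (F V.card (fun a => i (V.orderEmbOfFin rfl a))
        (fun a => onBlock G i (interpBlock V a.castSucc) b * b (V.orderEmbOfFin rfl a)))).comp L,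
        fun c => ?_⟩
      have hno : ∀ a : Fin V.card, x ∉ interpBlock V a.castSucc := fun a h =>
        absurd (interpBlock_disjoint h hlast) (Fin.castSucc_lt_last a).ne
      unfold compTerm
      simp only [onBlock_update_of_notMem G i (hno _), Function.update_of_ne (hne _), hL]
      rfl
    · obtain ⟨a, ha⟩ : ∃ a : Fin V.card, x ∈ interpBlock V a.castSucc := by
        obtain ⟨j, hj⟩ := exists_mem_interpBlock hV
        rcases Fin.eq_castSucc_or_eq_last j with ⟨a, rfl⟩ | rfl
        · exact ⟨a, hj⟩
        · exact absurd hj hlast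
      obtain ⟨L₀, hL₀⟩ := onBlock_slice G i ha b
      obtain ⟨L, hL⟩ := slice_arg (F V.card fun a => i (V.orderEmbOfFin rfl a))
        (fun c a => onBlock G i (interpBlock V a.castSucc) (Function.update b x c) *
          b (V.orderEmbOfFin rfl a)) a
        ((LinearMap.mulRight 𝕜 (b (V.orderEmbOfFin rfl a))).comp L₀)
        (fun c => by simp [hL₀])
        (fun a' ha' c => by
          have : x ∉ interpBlock V a'.castSucc := fun h =>
            ha' (Fin.castSucc_injective _ (interpBlock_disjoint h ha))
          simp only [onBlock_update_of_notMem G i this])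
      refine ⟨(LinearMap.mulRight 𝕜 (onBlock G i (interpBlock V (Fin.last _)) b)).comp L,
        fun c => ?_⟩
      unfold compTerm
      simp only [onBlock_update_of_notMem G i hlast, Function.update_of_ne (hne _)]
      rw [hL]
      rfl

theorem insertTerm_slice (F G : MulSeries 𝕜 𝔅 r) (i : Fin n → Fin r) (k m : Fin n)
    (b : Fin n → 𝔅) (x : Fin n) :
    ∃ L : 𝔅 →ₗ[𝕜] 𝔅, ∀ c, insertTerm F G i k m (Function.update b x c) = L c := by
  unfold insertTerm
  set W := (Finset.Icc k m)ᶜ with hW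
  set w := W.orderEmbOfFin rfl with hw
  have hwW : ∀ a, w a ∈ W := fun a => Finset.orderEmbOfFin_mem W rfl a
  have hrange : ∀ y, y ∈ W → ∃ a, w a = y := fun y hy => by
    have : y ∈ Set.range w := by rw [hw, Finset.range_orderEmbOfFin]; exact hy
    exact this
  by_cases hx : x ∈ Finset.Icc k m
  · have hne : ∀ a, w a ≠ x := fun a h => (Finset.mem_compl.mp (hwW a)) (h ▸ hx)
    obtain ⟨L₀, hL₀⟩ := onBlock_slice G i hx b
    simp only [Function.update_of_ne (hne _), hL₀]
    by_cases hm : (m : ℕ) + 1 = n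
    · have hno : ∀ a, (w a : ℕ) ≠ m + 1 := fun a h => by have := (w a).2; omega
      simp only [hno, if_pos hm, if_false]
      exact ⟨(LinearMap.mulLeft 𝕜 (F W.card (fun a => i (w a)) fun a => b (w a))).comp L₀,
        fun c => rfl⟩
    · have hlt : (m : ℕ) + 1 < n := by have := m.2; omega
      obtain ⟨a, ha⟩ := hrange ⟨m + 1, hlt⟩ (by
        rw [hW, Finset.mem_compl, Finset.mem_Icc, not_and]
        intro _ h
        exact absurd (Fin.le_def.mp h) (by simp))
      have ha' : (w a : ℕ) = m + 1 := by rw [ha]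
      simp only [hm, if_false, mul_one]
      refine slice_arg (F W.card fun a => i (w a)) _ a
        ((LinearMap.mulRight 𝕜 (b (w a))).comp L₀) (fun c => by simp [ha']) (fun a' hne' c => ?_)
      have : (w a' : ℕ) ≠ m + 1 := fun h =>
        hne' (w.injective (Fin.ext (h.trans ha'.symm)))
      simp only [this, if_false]
  · obtain ⟨a, ha⟩ := hrange x (Finset.mem_compl.mpr hx)
    simp only [onBlock_update_of_notMem G i hx]
    obtain ⟨L, hL⟩ := slice_arg (F W.card fun a => i (w a))
      (fun c a => if (w a : ℕ) = m + 1
        then onBlock G i (Finset.Icc k m) b * Function.update b x c (w a)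
        else Function.update b x c (w a)) a
      (if (w a : ℕ) = m + 1 then LinearMap.mulLeft 𝕜 (onBlock G i (Finset.Icc k m) b)
        else LinearMap.id)
      (fun c => by
        rw [ha, Function.update_self]
        split_ifs <;> rfl)
      (fun a' hne' c => by
        have : w a' ≠ x := fun h => hne' (w.injective (h.trans ha.symm))
        simp only [Function.update_of_ne this])
    refine ⟨(LinearMap.mulRight 𝕜
      (if (m : ℕ) + 1 = n then onBlock G i (Finset.Icc k m) b else 1)).comp L, fun c => ?_⟩
    exact congrArg (· * _) (hL c)

/-! ### The two operations -/

/-- The composition `F ⊙ G`: the sum of `compTerm F G i V` over all `V ⊆ {1,…,n}`. -/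
def comp (F G : MulSeries 𝕜 𝔅 r) : MulSeries 𝕜 𝔅 r := fun n i =>
  ∑ V : Finset (Fin n), mkOfSlices (compTerm F G i V) (compTerm_slice F G i V)

/-- The insertion product `F ⋆ G`: the sum of `insertTerm F G i k m` over all non-empty interval
blocks `{k,…,m}` of `{1,…,n}` when `n ≥ 1`; for `n = 0` the component is `F_∅ G_∅`. -/
def insertProd (F G : MulSeries 𝕜 𝔅 r) : MulSeries 𝕜 𝔅 r
  | 0, i => MultilinearMap.constOfIsEmpty 𝕜 _ (F 0 i ![] * G 0 i ![])
  | n + 1, i => ∑ v : Fin (n + 1) × Fin (n + 1) with v.1 ≤ v.2,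
      mkOfSlices (insertTerm F G i v.1 v.2) (insertTerm_slice F G i v.1 v.2)

/-- `F(t)` is a family whose components are polynomial in `t`, and `F'(t)` is the family of the
`t`-derivatives of its components. -/
def HasSeriesDeriv (F F' : 𝕜 → MulSeries 𝕜 𝔅 r) : Prop :=
  ∀ (n : ℕ) (i : Fin n → Fin r), HasPolyDeriv (fun t => F t n i) (fun t => F' t n i)

end Operations

/-! ## Operator-valued probability spaces -/

/-- An algebraic probability space `(A, 𝔅, φ)`: a unital algebra `A` containing `𝔅` as a unital
subalgebra (through `incl`, which is injective by `E_incl`), with a conditional expectation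
`φ = E : A → 𝔅`. -/
structure ProbSpace (𝕜 𝔅 A : Type*) [Field 𝕜] [Ring 𝔅] [Algebra 𝕜 𝔅] [Ring A] [Algebra 𝕜 A] where
  incl : 𝔅 →ₐ[𝕜] A
  E : A →ₗ[𝕜] 𝔅
  E_bimodule : ∀ (b₁ : 𝔅) (x : A) (b₂ : 𝔅), E (incl b₁ * x * incl b₂) = b₁ * E x * b₂
  E_incl : ∀ b : 𝔅, E (incl b) = b

section Probability

variable {𝕜 𝔅 A A' : Type*} [Field 𝕜] [Ring 𝔅] [Algebra 𝕜 𝔅] [Ring A] [Algebra 𝕜 A]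
  [Ring A'] [Algebra 𝕜 A']

/-- The linear map `𝔅 → A`, `b ↦ b x`. -/
def ProbSpace.mulLeftOf (P : ProbSpace 𝕜 𝔅 A) (x : A) : 𝔅 →ₗ[𝕜] A :=
  (LinearMap.mulRight 𝕜 x).comp P.incl.toLinearMap

/-- The generating family of moments
`μ^X_{i₁,…,iₙ}(b₁,…,bₙ) = φ(b₁ X_{i₁} b₂ X_{i₂} ⋯ bₙ X_{iₙ})`, with `μ^X_∅ = φ(1) = 1`. -/
def ProbSpace.moments (P : ProbSpace 𝕜 𝔅 A) {r : ℕ} (X : Fin r → A) : MulSeries 𝕜 𝔅 r :=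
  fun n i => P.E.compMultilinearMap
    ((MultilinearMap.mkPiAlgebraFin 𝕜 n A).compLinearMap fun j => P.mulLeftOf (X (i j)))

/-- Monotone independence over `𝔅` of a family of (not necessarily unital) subalgebras indexed by a
linearly ordered set: in `φ(x₁ ⋯ xₙ)` with `xₖ ∈ A_{lₖ}`, a factor `xₚ` whose index `lₚ` is strictly
larger than those of its neighbours may be replaced by `φ(xₚ)`. -/
def ProbSpace.MonotoneIndep (P : ProbSpace 𝕜 𝔅 A) {Λ : Type*} [LinearOrder Λ]
    (S : Λ → NonUnitalSubalgebra 𝕜 A) : Prop :=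
  ∀ (n : ℕ) (l : Fin n → Λ) (x : Fin n → A), (∀ k, x k ∈ S (l k)) →
    ∀ p : Fin n, (∀ k : Fin n, ((k : ℕ) + 1 = p ∨ (p : ℕ) + 1 = k) → l k < l p) →
      P.E (List.ofFn x).prod = P.E (List.ofFn (Function.update x p (P.incl (P.E (x p))))).prod

/-- Monotone i.i.d. copies `x ↦ x⁽ʲ⁾`, `j = 1, 2, …`, of the elements of `(A, 𝔅, φ)` in a second
algebraic probability space `(A', 𝔅, φ')` (`copy j` is the copy with number `j + 1`).  The copy maps
are multiplicative and `𝔅`-bilinear, but not unital. -/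
structure MonotoneCopies (P : ProbSpace 𝕜 𝔅 A) (P' : ProbSpace 𝕜 𝔅 A') where
  copy : ℕ → A →ₙₐ[𝕜] A'
  copy_bimodule : ∀ (j : ℕ) (b₁ : 𝔅) (x : A) (b₂ : 𝔅),
    copy j (P.incl b₁ * x * P.incl b₂) = P'.incl b₁ * copy j x * P'.incl b₂
  copy_distrib : ∀ (j n : ℕ) (x : Fin n → A), 1 ≤ n →
    P'.E (List.ofFn fun k => copy j (x k)).prod = P.E (List.ofFn x).prod
  copy_indep : P'.MonotoneIndep fun j => NonUnitalAlgHom.range (copy j)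

variable {P : ProbSpace 𝕜 𝔅 A} {P' : ProbSpace 𝕜 𝔅 A'}

/-- The dot operation `N.x = x⁽¹⁾ + ⋯ + x⁽ᴺ⁾`. -/
def MonotoneCopies.dot (D : MonotoneCopies P P') (N : ℕ) (x : A) : A' :=
  ∑ j ∈ Finset.range N, D.copy j x

/-- `(Kₙ)` is the family of the joint monotone cumulants: `φ'((N.x₁) ⋯ (N.xₙ))` is a polynomial in
`N`, and `Kₙ(x₁,…,xₙ)` is its coefficient of `N`. -/
def MonotoneCopies.IsCumulants (D : MonotoneCopies P P')
    (K : (n : ℕ) → MultilinearMap 𝕜 (fun _ : Fin n => A) 𝔅) : Prop :=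
  ∀ (n : ℕ) (x : Fin n → A), ∃ c : ℕ →₀ 𝔅,
    (∀ N : ℕ, P'.E (List.ofFn fun k => D.dot N (x k)).prod = polyEval c (N : 𝕜)) ∧ K n x = c 1

/-- `t ↦ M t` is the polynomial extension `t ↦ μ^{t.X}` of `N ↦ μ^{N.X}`. -/
def MonotoneCopies.IsDotMoments (D : MonotoneCopies P P') {r : ℕ} (X : Fin r → A)
    (M : 𝕜 → MulSeries 𝕜 𝔅 r) : Prop :=
  (∀ (n : ℕ) (i : Fin n → Fin r), IsPolyFun fun t => M t n i) ∧
    ∀ N : ℕ, M (N : 𝕜) = P'.moments fun k => D.dot N (X k)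

/-- The generating family of cumulants `κ^X_{i₁,…,iₙ}(b₁,…,bₙ) = Kₙ(b₁ X_{i₁}, …, bₙ X_{iₙ})` for
`n ≥ 1`, and `κ^X_∅ = 0`, formed with the joint cumulants `(Kₙ)`. -/
def ProbSpace.cumulantSeries (P : ProbSpace 𝕜 𝔅 A)
    (K : (n : ℕ) → MultilinearMap 𝕜 (fun _ : Fin n => A) 𝔅) {r : ℕ} (X : Fin r → A) :
    MulSeries 𝕜 𝔅 r
  | 0, _ => 0
  | n + 1, i => (K (n + 1)).compLinearMap fun j => P.mulLeftOf (X (i j))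

end Probability

end OpMonotone

end

noncomputable section

namespace OpMonotone

/-! ## Polynomial functions and their first order jets -/

section Jets

variable {𝕜 M M' : Type*} [Field 𝕜] [AddCommGroup M] [Module 𝕜 M] [AddCommGroup M'] [Module 𝕜 M']

/-! Everything is moved from families of multilinear maps to functions on words in `A`: a family F
is replaced by a function f with F(b₁,…,bₙ) = f(b₁X_{i₁}, …, bₙX_{iₙ}). A scalar produced by a block
is absorbed into the next letter, so both products have recursive descriptions, `listComp` and
`insertFrom`, which do not mention X or the bᵢ.

Let m_N be the moment function of the N-fold dot operation. Expand (N+M).x = N.x + (the copies with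
index at least N). By monotone independence each maximal run of large copies between small ones can
be replaced by its expectation, a value of m_M. This gives the semigroup law m_{N+M} = m_N ⊙ m_M
(`dotMoment_add`, based on `E_wordProd_block`).

With M = 1, the difference m_{N+1} − m_N on a word of length n involves only moments m_N of shorter
words, so n+1 forward differences vanish and N ↦ m_N is polynomial (`fwdDiff_iter_dotMoment`).

Both differential equations are the semigroup law differentiated at s = 0. In m_{s+t} = m_s ⊙ m_t
the product is linear in its left factor, whose coefficient of s is κ; this gives κ ⊙ m_t. In
m_{t+s} = m_t ⊙ m_s the right factor starts at the unit m₀, so to first order exactly one block is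
nontrivial; this gives m_t ⋆ κ. Derivatives are formal, read off from the coefficients of order 0
and 1 (`HasJet`). The law is used at natural arguments only, and polynomials that agree on ℕ are
equal. -/

/-- `polyEval` as a linear function of the coefficients. -/
def polyEvalₗ (t : 𝕜) : (ℕ →₀ M) →ₗ[𝕜] M :=
  Finsupp.lsum 𝕜 fun k => t ^ k • LinearMap.id

theorem polyEvalₗ_apply (t : 𝕜) (c : ℕ →₀ M) : polyEvalₗ t c = polyEval c t := rfl

theorem polyEval_single (k : ℕ) (m : M) (t : 𝕜) :
    polyEval (Finsupp.single k m) t = t ^ k • m := by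
  simp [polyEval]

theorem polyEval_zero (c : ℕ →₀ M) : polyEval c (0 : 𝕜) = c 0 := by
  simp [polyEval, Finsupp.sum, zero_pow_eq, ite_smul, eq_comm]

theorem polyEval_mapRange (L : M →ₗ[𝕜] M') (c : ℕ →₀ M) (t : 𝕜) :
    polyEval (c.mapRange L L.map_zero) t = L (polyEval c t) := by
  unfold polyEval
  rw [Finsupp.sum_mapRange_index (by simp), Finsupp.sum, Finsupp.sum, map_sum]
  simp

theorem polyDerivEval_mapRange (L : M →ₗ[𝕜] M') (c : ℕ →₀ M) (t : 𝕜) :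
    polyDerivEval (c.mapRange L L.map_zero) t = L (polyDerivEval c t) := by
  unfold polyDerivEval
  rw [Finsupp.sum_mapRange_index (by simp), Finsupp.sum, Finsupp.sum, map_sum]
  simp

theorem polyEval_eq_sum {c : ℕ →₀ 𝕜} (t : 𝕜) :
    polyEval c t = (Polynomial.ofFinsupp (AddMonoidAlgebra.ofCoeff c)).eval t := by
  rw [Polynomial.eval_eq_sum]
  simp [polyEval, Polynomial.sum, Finsupp.sum, mul_comm]

/-- A polynomial with coefficients in a vector space is determined by its values on `ℕ`. -/
theorem polyEval_injective_nat [CharZero 𝕜] {c c' : ℕ →₀ M}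
    (h : ∀ N : ℕ, polyEval c (N : 𝕜) = polyEval c' (N : 𝕜)) : c = c' := by
  rw [← sub_eq_zero]
  ext k
  -- Linear functionals separate the points of a vector space, so the claim reduces to a scalar
  -- polynomial with infinitely many roots.
  rw [Finsupp.zero_apply, ← Module.forall_dual_apply_eq_zero_iff 𝕜]
  intro φ
  set d := (c - c').mapRange φ φ.map_zero with hd
  have h0 : ∀ N : ℕ, polyEval d (N : 𝕜) = 0 := fun N => by
    rw [hd, polyEval_mapRange, ← polyEvalₗ_apply, map_sub, polyEvalₗ_apply, polyEvalₗ_apply, h,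
      sub_self, map_zero]
  have hp : Polynomial.ofFinsupp (AddMonoidAlgebra.ofCoeff d) = 0 := by
    refine Polynomial.eq_zero_of_infinite_isRoot _ ?_
    refine (Set.infinite_range_of_injective (Nat.cast_injective (R := 𝕜))).mono ?_
    rintro _ ⟨N, rfl⟩
    exact (polyEval_eq_sum _).symm.trans (h0 N)
  have := congrArg (fun p => p.coeff k) hp
  simpa [hd] using this

/-- `f` is a polynomial function whose coefficients of order `0` and `1` are `a` and `b`. -/
def HasJet (f : 𝕜 → M) (a b : M) : Prop :=
  ∃ c : ℕ →₀ M, (∀ t, f t = polyEval c t) ∧ c 0 = a ∧ c 1 = b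

theorem HasJet.isPolyFun {f : 𝕜 → M} {a b : M} (h : HasJet f a b) : IsPolyFun f :=
  let ⟨c, hc, _⟩ := h
  ⟨c, hc⟩

theorem IsPolyFun.hasJet {f : 𝕜 → M} (h : IsPolyFun f) : ∃ a b, HasJet f a b :=
  let ⟨c, hc⟩ := h
  ⟨_, _, c, hc, rfl, rfl⟩

theorem HasJet.const (a : M) : HasJet (fun _ : 𝕜 => a) a 0 :=
  ⟨Finsupp.single 0 a, fun t => by simp [polyEval_single], by simp, by simp⟩

theorem HasJet.add {f g : 𝕜 → M} {a b a' b' : M} (hf : HasJet f a b) (hg : HasJet g a' b') :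
    HasJet (fun t => f t + g t) (a + a') (b + b') := by
  obtain ⟨c, hc, rfl, rfl⟩ := hf
  obtain ⟨c', hc', rfl, rfl⟩ := hg
  exact ⟨c + c', fun t => by
    simp only [hc, hc']
    rw [← polyEvalₗ_apply, ← polyEvalₗ_apply, ← polyEvalₗ_apply, map_add], rfl, rfl⟩

theorem HasJet.map {f : 𝕜 → M} {a b : M} (L : M →ₗ[𝕜] M') (hf : HasJet f a b) :
    HasJet (fun t => L (f t)) (L a) (L b) := by
  obtain ⟨c, hc, rfl, rfl⟩ := hf
  exact ⟨c.mapRange L L.map_zero, fun t => by simp only [hc, polyEval_mapRange], by simp, by simp⟩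

theorem HasJet.sum {ι : Type*} (s : Finset ι) {f : ι → 𝕜 → M} {a b : ι → M}
    (h : ∀ i ∈ s, HasJet (f i) (a i) (b i)) :
    HasJet (fun t => ∑ i ∈ s, f i t) (∑ i ∈ s, a i) (∑ i ∈ s, b i) := by
  classical
  induction s using Finset.induction_on with
  | empty => simpa using HasJet.const (𝕜 := 𝕜) (0 : M)
  | insert i s hi ih =>
    simp only [Finset.sum_insert hi]
    exact (h i (by simp)).add (ih fun j hj => h j (by simp [hj]))

theorem HasJet.congr {f g : 𝕜 → M} {a b : M} (hf : HasJet f a b) (h : ∀ t, g t = f t) :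
    HasJet g a b := by
  rwa [show g = f from funext h]

theorem HasJet.unique [CharZero 𝕜] {f g : 𝕜 → M} {a b a' b' : M} (hf : HasJet f a b)
    (hg : HasJet g a' b') (h : ∀ N : ℕ, f N = g N) : f = g ∧ a = a' ∧ b = b' := by
  obtain ⟨c, hc, rfl, rfl⟩ := hf
  obtain ⟨c', hc', rfl, rfl⟩ := hg
  obtain rfl : c = c' := polyEval_injective_nat (𝕜 := 𝕜) fun N => by rw [← hc, ← hc', h]
  exact ⟨funext fun t => by rw [hc, hc'], rfl, rfl⟩

/-- The jet of a scalar polynomial times a vector. -/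
theorem HasJet.polynomial_smul (p : Polynomial 𝕜) (m : M) :
    HasJet (fun t => p.eval t • m) (p.coeff 0 • m) (p.coeff 1 • m) := by
  refine ⟨p.toFinsupp.coeff.mapRange (LinearMap.toSpanSingleton 𝕜 M m) (map_zero _), fun t => ?_,
    ?_, ?_⟩
  · rw [polyEval_mapRange, polyEval_eq_sum]
    rfl
  · simp; rfl
  · simp; rfl

theorem HasJet.pow_smul (k : ℕ) {f : 𝕜 → M} {a b : M} (hf : HasJet f a b) :
    HasJet (fun t => t ^ k • f t) (if k = 0 then a else 0)
      (if k = 0 then b else if k = 1 then a else 0) := by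
  obtain ⟨c, hc, rfl, rfl⟩ := hf
  refine ⟨c.embDomain (addRightEmbedding k), fun t => ?_, ?_, ?_⟩
  · simp only [hc]
    rw [polyEval, polyEval, Finsupp.sum_embDomain, Finsupp.smul_sum]
    refine Finsupp.sum_congr fun j _ => ?_
    rw [smul_smul, addRightEmbedding_apply, pow_add, mul_comm]
  · rcases k with _ | k
    · exact Finsupp.embDomain_apply_self _ _ 0
    · rw [if_neg (by omega)]
      exact Finsupp.embDomain_of_notMem_range _ _ _ (by simp)
  · rcases k with _ | _ | k
    · exact Finsupp.embDomain_apply_self _ _ 1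
    · exact Finsupp.embDomain_apply_self (addRightEmbedding 1) c 0
    · rw [if_neg (by omega), if_neg (by omega)]
      exact Finsupp.embDomain_of_notMem_range _ _ _ (by simp; omega)

/-- The jet of `t ↦ g(t)(f(t))`, where `g(t)` is linear and `g(t)(m)` is polynomial for each `m`. -/
theorem HasJet.apply {f : 𝕜 → M} {a b : M} {g : 𝕜 → M →ₗ[𝕜] M'} {α β : M → M'}
    (hf : HasJet f a b) (hg : ∀ m, HasJet (fun t => g t m) (α m) (β m)) :
    HasJet (fun t => g t (f t)) (α a) (β a + α b) := by
  obtain ⟨c, hc, rfl, rfl⟩ := hf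
  -- The indices 0 and 1 are adjoined so that their terms can be split off even when the
  -- coefficients vanish; terms with k ≥ 2 do not reach the jet.
  set s := c.support ∪ {0, 1} with hs
  have h := HasJet.sum s fun k _ => (hg (c k)).pow_smul k
  have h0 : 0 ∈ s := by simp [hs]
  have h1 : 1 ∈ s.erase 0 := by simp [hs]
  have hβ : ∑ k ∈ s, (if k = 0 then β (c k) else if k = 1 then α (c k) else 0) =
      β (c 0) + α (c 1) := by
    rw [← Finset.add_sum_erase _ _ h0, if_pos rfl]
    congr 1
    rw [← Finset.add_sum_erase _ _ h1, if_neg one_ne_zero, if_pos rfl, Finset.sum_eq_zero, add_zero]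
    intro k hk
    simp only [Finset.mem_erase] at hk
    rw [if_neg hk.2.1, if_neg hk.1]
  rw [hβ, Finset.sum_ite_eq' s 0 fun k => α (c k), if_pos h0] at h
  refine h.congr fun t => ?_
  rw [hc, polyEval, Finsupp.sum_of_support_subset c (s := s) Finset.subset_union_left _ (by simp),
    map_sum]
  simp only [map_smul]

/-- Taylor expansion at `t`. It turns differentiation at an arbitrary point into reading off the
linear coefficient of a shifted polynomial. -/
theorem HasJet.translate (c : ℕ →₀ M) (t : 𝕜) :
    HasJet (fun s => polyEval c (s + t)) (polyEval c t) (polyDerivEval c t) := by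
  unfold polyEval polyDerivEval Finsupp.sum
  refine HasJet.sum _ fun k _ => ?_
  have := HasJet.polynomial_smul ((Polynomial.X + Polynomial.C t) ^ k) (c k)
  simpa [Polynomial.coeff_X_add_C_pow, mul_comm] using this

theorem isPolyFun_polyDerivEval (c : ℕ →₀ M) : IsPolyFun fun t : 𝕜 => polyDerivEval c t := by
  have h := HasJet.sum c.support fun k _ =>
    HasJet.polynomial_smul (Polynomial.C (k : 𝕜) * Polynomial.X ^ (k - 1)) (c k)
  exact (h.congr fun t => by simp [polyDerivEval, Finsupp.sum]).isPolyFun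

theorem IsPolyFun.add {f g : 𝕜 → M} (hf : IsPolyFun f) (hg : IsPolyFun g) :
    IsPolyFun fun t => f t + g t :=
  let ⟨_, _, hf⟩ := hf.hasJet
  let ⟨_, _, hg⟩ := hg.hasJet
  (hf.add hg).isPolyFun

theorem IsPolyFun.map {f : 𝕜 → M} (L : M →ₗ[𝕜] M') (hf : IsPolyFun f) :
    IsPolyFun fun t => L (f t) :=
  let ⟨_, _, hf⟩ := hf.hasJet
  (hf.map L).isPolyFun

theorem IsPolyFun.eq_of_nat [CharZero 𝕜] {f g : 𝕜 → M} (hf : IsPolyFun f) (hg : IsPolyFun g)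
    (h : ∀ N : ℕ, f N = g N) : f = g :=
  let ⟨_, _, hf⟩ := hf.hasJet
  let ⟨_, _, hg⟩ := hg.hasJet
  (hf.unique hg h).1

/-! ### Finite differences and Newton interpolation -/

theorem fwdDiff_iter_comp_addMonoidHom {M M' : Type*} [AddCommGroup M] [AddCommGroup M']
    (L : M →+ M') (f : ℕ → M) (d N : ℕ) :
    (fwdDiff 1)^[d] (fun N => L (f N)) N = L ((fwdDiff 1)^[d] f N) := by
  induction d generalizing f with
  | zero => rfl
  | succ d ih =>
    have h : fwdDiff 1 (fun N => L (f N)) = fun N => L (fwdDiff 1 f N) :=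
      funext fun N => (map_sub L _ _).symm
    rw [Function.iterate_succ_apply, Function.iterate_succ_apply, ← ih, h]

/-- A sequence whose iterated forward differences vanish is polynomial. -/
theorem exists_polyEval_of_fwdDiff_iter_eq_zero [CharZero 𝕜] {f : ℕ → M} {d : ℕ}
    (h : (fwdDiff 1)^[d] f = 0) : ∃ c : ℕ →₀ M, ∀ N : ℕ, f N = polyEval c (N : 𝕜) := by
  have hz : ∀ k, d ≤ k → (fwdDiff 1)^[k] f = 0 := fun k hk => by
    obtain ⟨j, rfl⟩ := Nat.exists_eq_add_of_le' hk
    rw [Function.iterate_add_apply, h]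
    clear h hk
    induction j with
    | zero => rfl
    | succ j ih =>
      rw [Function.iterate_succ_apply', ih]
      funext N
      simp [fwdDiff]
  -- The witness is Newton's interpolation polynomial, with binomial coefficients written as falling
  -- factorials divided by `k!`.
  obtain ⟨c, hc⟩ : IsPolyFun fun t : 𝕜 => ∑ k ∈ Finset.range d,
      ((Polynomial.C ((k.factorial : 𝕜)⁻¹) * descPochhammer 𝕜 k).eval t) • (fwdDiff 1)^[k] f 0 :=
    (HasJet.sum _ fun k _ => HasJet.polynomial_smul _ _).isPolyFun
  refine ⟨c, fun N => ?_⟩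
  rw [← hc]
  have := shift_eq_sum_fwdDiff_iter 1 f N 0
  rw [zero_add, smul_eq_mul, mul_one] at this
  rw [this]
  have hs : ∀ k, N.choose k • (fwdDiff 1)^[k] f 0 =
      ((Polynomial.C ((k.factorial : 𝕜)⁻¹) * descPochhammer 𝕜 k).eval (N : 𝕜)) •
        (fwdDiff 1)^[k] f 0 := fun k => by
    rw [Polynomial.eval_mul, Polynomial.eval_C, descPochhammer_eval_eq_descFactorial,
      Nat.descFactorial_eq_factorial_mul_choose, Nat.cast_mul, inv_mul_cancel_left₀,
      Nat.cast_smul_eq_nsmul]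
    exact_mod_cast k.factorial_ne_zero
  simp_rw [← hs]
  -- Newton's formula stops at `k = N`, the polynomial at `k = d - 1`. Both sums extend by zeros to
  -- a common range: binomials vanish beyond `N`, differences from order `d` on.
  refine (Finset.sum_subset (Finset.range_mono (le_max_left (N + 1) d)) ?_).trans
    (Finset.sum_subset (Finset.range_mono (le_max_right (N + 1) d)) ?_).symm
  · intro k _ hk
    rw [Nat.choose_eq_zero_of_lt (by simpa using hk), zero_smul]
  · intro k _ hk
    rw [hz k (by simpa using hk)]
    simp

end Jets

/-! ## The two operations on words

A family of multilinear functionals is replaced here by a function on lists of elements of `A`. -/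

section Words

variable {α β : Type*}

/-- The sum over all ways to select some letters of a word: a selected letter `x`, preceded by the
block `c` of letters skipped since the last selection, contributes `act c x` to the list `p` of the
selected letters. The function `h` is applied to the final values of `p` and `c`. -/
def foldSum [Add β] (act : List α → α → α) (h : List α → List α → β) :
    List α → List α → List α → β
  | p, c, [] => h p c
  | p, c, x :: l => foldSum act h (p ++ [act c x]) [] l + foldSum act h p (c ++ [x]) l

/-- The recursion reads from the left, while subsets of `{0,…,n}` are split according to their last
element; the last letter is therefore absorbed into the final function `h`. -/
theorem foldSum_append_singleton [Add β] (act : List α → α → α) (h : List α → List α → β)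
    (p c l : List α) (x : α) :
    foldSum act h p c (l ++ [x]) =
      foldSum act (fun p c => h (p ++ [act c x]) [] + h p (c ++ [x])) p c l := by
  induction l generalizing p c with
  | nil => rfl
  | cons z l ih => simp only [List.cons_append, foldSum, ih]

/-- The letters of a word at the positions before `m` and after all those `w ∈ V` with `w < m`. -/
def gap (y : ℕ → α) (V : Finset ℕ) (m : ℕ) : List α :=
  ((List.range m).filter fun x => ∀ w ∈ V, w < m → w < x).map y

theorem gap_succ_of_subset (y : ℕ → α) {V : Finset ℕ} {n : ℕ} (hV : V ⊆ Finset.range n) :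
    gap y V (n + 1) = gap y V n ++ [y n] := by
  have hV' : ∀ w ∈ V, w < n := fun w hw => Finset.mem_range.mp (hV hw)
  unfold gap
  rw [List.range_succ, List.filter_append, List.map_append]
  congr 1
  · congr 1
    refine List.filter_congr fun x _ => ?_
    simp only [decide_eq_decide]
    exact ⟨fun h w hw _ => h w hw (Nat.lt_succ_of_lt (hV' w hw)), fun h w hw _ => h w hw (hV' w hw)⟩
  · rw [List.filter_cons_of_pos (by simpa using fun w hw _ => hV' w hw)]
    rfl

theorem gap_insert_of_le (y : ℕ → α) (V : Finset ℕ) {n m : ℕ} (hm : m ≤ n) :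
    gap y (insert n V) m = gap y V m := by
  unfold gap
  congr 1
  refine List.filter_congr fun x _ => ?_
  simp [hm]

theorem gap_insert_succ (y : ℕ → α) (V : Finset ℕ) (n : ℕ) :
    gap y (insert n V) (n + 1) = [] := by
  unfold gap
  rw [List.map_eq_nil_iff, List.filter_eq_nil_iff]
  intro x hx
  simp only [List.mem_range] at hx
  simp only [decide_eq_true_eq]
  intro h
  have := h n (Finset.mem_insert_self n V) (Nat.lt_succ_self n)
  omega

/-- Selecting letters one by one is the same as choosing the set `V` of selected positions. In the
induction, `V` with and without its possible last element `n` gives the two summands of the modified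
`h`, which is why `h` must vary. -/
theorem sum_powerset_range_eq_foldSum [AddCommMonoid β] (act : List α → α → α)
    (h : List α → List α → β) (y : ℕ → α) (n : ℕ) :
    ∑ V ∈ (Finset.range n).powerset,
      h (((List.range n).filter (· ∈ V)).map fun v => act (gap y V v) (y v)) (gap y V n) =
      foldSum act h [] [] ((List.range n).map y) := by
  induction n generalizing h with
  | zero => simp [foldSum, gap]
  | succ n ih =>
    rw [List.range_succ, List.map_append, List.map_singleton, foldSum_append_singleton, ← ih,
      Finset.range_add_one, Finset.sum_powerset_insert Finset.notMem_range_self,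
      ← Finset.sum_add_distrib]
    refine Finset.sum_congr rfl fun V hV => ?_
    rw [Finset.mem_powerset] at hV
    have hn : n ∉ V := fun h => Finset.notMem_range_self (hV h)
    rw [add_comm]
    congr 1
    · rw [gap_insert_succ, List.filter_append, List.map_append]
      congr 2
      · have : (List.range n).filter (· ∈ insert n V) = (List.range n).filter (· ∈ V) :=
          List.filter_congr fun x hx => by
            have : x ≠ n := (List.mem_range.mp hx).ne
            simp [this]
        rw [this]
        refine List.map_congr_left fun v hv => ?_
        rw [gap_insert_of_le]
        exact (List.mem_range.mp (List.mem_of_mem_filter hv)).le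
      · simp [gap_insert_of_le]
    · rw [gap_succ_of_subset y hV, List.filter_append]
      simp [hn]

/-- Extension of a function on `Fin n` to the natural numbers. -/
def extendFin [Zero α] {n : ℕ} (y : Fin n → α) (k : ℕ) : α :=
  if h : k < n then y ⟨k, h⟩ else 0

theorem extendFin_val [Zero α] {n : ℕ} (y : Fin n → α) (k : Fin n) :
    extendFin y k = y k := by
  simp [extendFin]

theorem sort_eq_filter_finRange {n : ℕ} (V : Finset (Fin n)) :
    V.sort (· ≤ ·) = (List.finRange n).filter (· ∈ V) := by
  have hV : ((List.finRange n).filter (· ∈ V)).toFinset = V := by ext; simp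
  have h := (List.toFinset_sort (· ≤ ·) ((List.nodup_finRange n).filter (· ∈ V))).mpr
    ((List.pairwise_le_finRange n).filter _)
  rwa [hV] at h

theorem map_filter_finRange {n : ℕ} (y : Fin n → α) (z : ℕ → α) (hz : ∀ k : Fin n, z k = y k)
    (p : Fin n → Bool) (q : ℕ → Bool) (hq : ∀ k : Fin n, q k = p k) :
    ((List.finRange n).filter p).map y = ((List.range n).filter q).map z := by
  rw [← List.map_coe_finRange_eq_range, List.filter_map, List.map_map]
  have : q ∘ (fun k : Fin n => (k : ℕ)) = p := funext hq
  rw [this]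
  exact List.map_congr_left fun k _ => (hz k).symm

theorem ofFn_orderEmbOfFin {n : ℕ} (V : Finset (Fin n)) (y : Fin n → α) :
    (List.ofFn fun a : Fin V.card => y (V.orderEmbOfFin rfl a)) =
      ((List.finRange n).filter (· ∈ V)).map y := by
  rw [← sort_eq_filter_finRange, ← Finset.listMap_orderEmbOfFin_finRange V rfl, List.map_map,
    List.ofFn_eq_map]
  rfl

theorem filter_range_lt_and {n m : ℕ} (hm : m ≤ n) (p : ℕ → Prop) [DecidablePred p] :
    (List.range n).filter (fun x => x < m ∧ p x) = (List.range m).filter p := by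
  obtain ⟨k, rfl⟩ := Nat.exists_eq_add_of_le hm
  have h : ((List.range k).map (m + ·)).filter (fun x => decide (x < m ∧ p x)) = [] := by simp
  rw [List.range_add, List.filter_append, h, List.append_nil]
  exact List.filter_congr fun x hx => by simp [List.mem_range.mp hx]

end Words

/-! ### Families of multilinear maps as functions on words -/

section Bridge

variable {𝕜 𝔅 A : Type*} [Field 𝕜] [Ring 𝔅] [Algebra 𝕜 𝔅] [Ring A] [Algebra 𝕜 A] {r : ℕ}

/-- The composition of two functions on words. -/
def listComp (ι : 𝔅 →ₐ[𝕜] A) (f g : List A → 𝔅) (l : List A) : 𝔅 :=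
  foldSum (fun c x => ι (g c) * x) (fun p c => f p * g c) [] [] l

/-- `F` is the family of multilinear functionals `b ↦ f (b₁ X_{i₁}, …, bₙ X_{iₙ})`. -/
def Represents (ι : 𝔅 →ₐ[𝕜] A) (X : Fin r → A) (F : MulSeries 𝕜 𝔅 r) (f : List A → 𝔅) : Prop :=
  ∀ (n : ℕ) (i : Fin n → Fin r) (b : Fin n → 𝔅),
    F n i b = f (List.ofFn fun k => ι (b k) * X (i k))

variable {ι : 𝔅 →ₐ[𝕜] A} {X : Fin r → A} {F G : MulSeries 𝕜 𝔅 r} {f g : List A → 𝔅} {n : ℕ}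

theorem Represents.onBlock (hG : Represents ι X G g) (i : Fin n → Fin r) (b : Fin n → 𝔅)
    (W : Finset (Fin n)) (q : ℕ → Bool) (hq : ∀ k : Fin n, q k = decide (k ∈ W)) :
    onBlock G i W b =
      g (((List.range n).filter q).map (extendFin fun k => ι (b k) * X (i k))) := by
  unfold OpMonotone.onBlock
  rw [hG, ofFn_orderEmbOfFin W fun k => ι (b k) * X (i k),
    map_filter_finRange _ _ (extendFin_val _) _ q hq]

theorem mem_interpBlock_castSucc {V : Finset (Fin n)} {a : Fin V.card} {x : Fin n} :
    x ∈ interpBlock V a.castSucc ↔ x < V.orderEmbOfFin rfl a ∧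
      ∀ w ∈ V, w < V.orderEmbOfFin rfl a → w < x := by
  have hr : ∀ w ∈ V, ∃ a, V.orderEmbOfFin rfl a = w := fun w hw => by
    have : w ∈ Set.range (V.orderEmbOfFin rfl) := by rwa [Finset.range_orderEmbOfFin]
    exact this
  simp only [interpBlock, Finset.mem_filter, Finset.mem_univ, true_and,
    Fin.castSucc_lt_castSucc_iff, Fin.castSucc_le_castSucc_iff]
  constructor
  · rintro ⟨h1, h2⟩
    refine ⟨h2 a le_rfl, fun w hw hlt => ?_⟩
    obtain ⟨a', rfl⟩ := hr w hw
    exact h1 a' ((V.orderEmbOfFin rfl).lt_iff_lt.mp hlt)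
  · rintro ⟨h1, h2⟩
    exact ⟨fun a' h => h2 _ (Finset.orderEmbOfFin_mem V rfl a') ((V.orderEmbOfFin rfl).strictMono h),
      fun a' h => h1.trans_le ((V.orderEmbOfFin rfl).monotone h)⟩

theorem mem_interpBlock_last {V : Finset (Fin n)} {x : Fin n} :
    x ∈ interpBlock V (Fin.last _) ↔ ∀ w ∈ V, w < x := by
  have hr : ∀ w ∈ V, ∃ a, V.orderEmbOfFin rfl a = w := fun w hw => by
    have : w ∈ Set.range (V.orderEmbOfFin rfl) := by rwa [Finset.range_orderEmbOfFin]
    exact this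
  simp only [interpBlock, Finset.mem_filter, Finset.mem_univ, true_and]
  constructor
  · rintro ⟨h1, -⟩ w hw
    obtain ⟨a, rfl⟩ := hr w hw
    exact h1 a (Fin.castSucc_lt_last a)
  · intro h
    exact ⟨fun a _ => h _ (Finset.orderEmbOfFin_mem V rfl a),
      fun a ha => absurd ha (not_le.mpr (Fin.castSucc_lt_last a))⟩

theorem Represents.compTerm (hF : Represents ι X F f) (hG : Represents ι X G g)
    (i : Fin n → Fin r) (b : Fin n → 𝔅) (V : Finset (Fin n)) :
    compTerm F G i V b =
      f (((List.range n).filter (· ∈ V.map Fin.valEmbedding)).map fun v =>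
          ι (g (gap (extendFin fun k => ι (b k) * X (i k)) (V.map Fin.valEmbedding) v)) *
            extendFin (fun k => ι (b k) * X (i k)) v) *
        g (gap (extendFin fun k => ι (b k) * X (i k)) (V.map Fin.valEmbedding) n) := by
  set y : Fin n → A := fun k => ι (b k) * X (i k) with hy
  set U := V.map Fin.valEmbedding with hU
  have hgap : ∀ a : Fin V.card, OpMonotone.onBlock G i (interpBlock V a.castSucc) b =
      g (gap (extendFin y) U (V.orderEmbOfFin rfl a : Fin n)) := fun a => by
    rw [hG.onBlock i b _ (fun x => x < (V.orderEmbOfFin rfl a : Fin n) ∧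
      ∀ w ∈ U, w < (V.orderEmbOfFin rfl a : Fin n) → w < x), filter_range_lt_and (Fin.is_lt _).le]
    · rfl
    · intro k
      simp [mem_interpBlock_castSucc, hU]
  have hlast : OpMonotone.onBlock G i (interpBlock V (Fin.last _)) b = g (gap (extendFin y) U n) := by
    rw [hG.onBlock i b _ (fun x => ∀ w ∈ U, w < n → w < x)]
    · rfl
    · intro k
      simp [mem_interpBlock_last, hU]
  unfold OpMonotone.compTerm
  rw [hF, hlast]
  congr 2
  -- The scalar of the preceding block enters the argument to the left of `b_v`, so by
  -- multiplicativity of `ι` it multiplies the whole letter `b_v X_v`.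
  have : ∀ a : Fin V.card, ι (OpMonotone.onBlock G i (interpBlock V a.castSucc) b *
      b (V.orderEmbOfFin rfl a)) * X (i (V.orderEmbOfFin rfl a)) =
      (fun v : Fin n => ι (g (gap (extendFin y) U v)) * y v) (V.orderEmbOfFin rfl a) := fun a => by
    rw [hgap, map_mul, mul_assoc]
  simp only [this]
  rw [ofFn_orderEmbOfFin V fun v : Fin n => ι (g (gap (extendFin y) U v)) * y v]
  exact map_filter_finRange _ _ (fun k => by rw [extendFin_val]) _ _ fun k => by simp [hU, Fin.val_inj]

theorem map_extendFin_range (y : Fin n → A) :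
    (List.range n).map (extendFin y) = List.ofFn y := by
  rw [← List.map_coe_finRange_eq_range, List.map_map, List.ofFn_eq_map]
  exact List.map_congr_left fun k _ => extendFin_val y k

theorem Represents.comp (hF : Represents ι X F f) (hG : Represents ι X G g) :
    Represents ι X (comp F G) (listComp ι f g) := by
  intro n i b
  have h : OpMonotone.comp F G n i b = ∑ V : Finset (Fin n), OpMonotone.compTerm F G i V b := by
    unfold OpMonotone.comp
    rw [_root_.sum_apply]
    rfl
  rw [h, listComp, ← map_extendFin_range, ← sum_powerset_range_eq_foldSum]
  refine Finset.sum_nbij (fun V => V.map Fin.valEmbedding) ?_ ?_ ?_ ?_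
  · intro V _
    simp only [Finset.mem_powerset]
    intro x hx
    simp only [Finset.mem_map] at hx
    obtain ⟨k, _, rfl⟩ := hx
    simp
  · exact (Finset.map_injective _).injOn
  · intro U hU
    simp only [Finset.coe_powerset, Set.mem_preimage, Set.mem_powerset_iff, Finset.coe_subset] at hU
    refine ⟨Finset.univ.filter fun k : Fin n => (k : ℕ) ∈ U, by simp, ?_⟩
    ext x
    simp only [Finset.mem_map, Finset.mem_filter, Finset.mem_univ, true_and]
    exact ⟨fun ⟨k, hk, h⟩ => h ▸ hk, fun hx => ⟨⟨x, Finset.mem_range.mp (hU hx)⟩, hx, rfl⟩⟩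
  · intro V _
    exact hF.compTerm hG i b V

/-! ### The insertion product on words -/

/-- The word `u w v` with the block `w` replaced by its value `g w`, which is absorbed by the next
letter, or multiplied from the right if there is none. -/
def insertWord (ι : 𝔅 →ₐ[𝕜] A) (f g : List A → 𝔅) (u w : List A) : List A → 𝔅
  | [] => f u * g w
  | x :: v => f (u ++ ι (g w) * x :: v)

/-- The sum of `insertWord` over all blocks that extend `w` to the right. -/
def insertExtend (ι : 𝔅 →ₐ[𝕜] A) (f g : List A → 𝔅) (u : List A) : List A → List A → 𝔅
  | w, [] => insertWord ι f g u w []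
  | w, x :: v => insertWord ι f g u w (x :: v) + insertExtend ι f g u (w ++ [x]) v

/-- The sum of `insertWord` over all non-empty blocks to the right of `u`. -/
def insertFrom (ι : 𝔅 →ₐ[𝕜] A) (f g : List A → 𝔅) : List A → List A → 𝔅
  | _, [] => 0
  | u, x :: l => insertFrom ι f g (u ++ [x]) l + insertExtend ι f g u [x] l

theorem insertExtend_eq_sum (u w l : List A) :
    insertExtend ι f g u w l =
      ∑ j ∈ Finset.range (l.length + 1), insertWord ι f g u (w ++ l.take j) (l.drop j) := by
  induction l generalizing w with
  | nil => simp [insertExtend]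
  | cons x l ih =>
    rw [insertExtend, ih, List.length_cons, Finset.sum_range_succ' _ (l.length + 1), add_comm]
    simp

/-- Here `k` is the number of letters before the block and `j + 1` its length, so that empty blocks
are excluded. -/
theorem insertFrom_eq_sum (u l : List A) :
    insertFrom ι f g u l = ∑ k ∈ Finset.range l.length, ∑ j ∈ Finset.range (l.length - k),
      insertWord ι f g (u ++ l.take k) ((l.drop k).take (j + 1)) (l.drop (k + (j + 1))) := by
  induction l generalizing u with
  | nil => simp [insertFrom]
  | cons x l ih =>
    rw [List.length_cons, Finset.sum_range_succ', insertFrom, ih, insertExtend_eq_sum]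
    refine congrArg₂ (· + ·) (Finset.sum_congr rfl fun k _ => ?_) ?_
    · rw [Nat.add_sub_add_right]
      refine Finset.sum_congr rfl fun j _ => ?_
      rw [Nat.add_right_comm k 1]
      simp
    · simp

theorem range_eq_append_of_le {n k m : ℕ} (hkm : k ≤ m) (hm : m < n) :
    List.range n = List.range k ++ (List.range' k (m - k + 1) ++
      List.range' (m + 1) (n - (m + 1))) := by
  obtain ⟨a, rfl⟩ := Nat.exists_eq_add_of_le hkm
  obtain ⟨d, rfl⟩ := Nat.exists_eq_add_of_lt hm
  have h1 : k + a - k + 1 = a + 1 := by omega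
  have h2 : k + a + d + 1 - (k + a + 1) = d := by omega
  have h3 := List.range'_append_1 (s := k) (m := a + 1) (n := d)
  have h4 := List.range'_append_1 (s := 0) (m := k) (n := a + 1 + d)
  rw [zero_add] at h4
  rw [h1, h2, add_assoc k a 1, h3, List.range_eq_range', List.range_eq_range', h4]
  congr 1
  omega

theorem filter_range_Icc {n k m : ℕ} (hkm : k ≤ m) (hm : m < n) :
    (List.range n).filter (fun x => k ≤ x ∧ x ≤ m) = List.range' k (m - k + 1) := by
  have h1 : (List.range k).filter (fun x => k ≤ x ∧ x ≤ m) = [] := by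
    simp only [List.filter_eq_nil_iff, List.mem_range, decide_eq_true_eq]
    omega
  have h2 : (List.range' k (m - k + 1)).filter (fun x => k ≤ x ∧ x ≤ m) =
      List.range' k (m - k + 1) := by
    simp only [List.filter_eq_self, List.mem_range'_1, decide_eq_true_eq]
    omega
  have h3 : (List.range' (m + 1) (n - (m + 1))).filter (fun x => k ≤ x ∧ x ≤ m) = [] := by
    simp only [List.filter_eq_nil_iff, List.mem_range'_1, decide_eq_true_eq]
    omega
  rw [range_eq_append_of_le hkm hm, List.filter_append, List.filter_append, h1, h2, h3,
    List.nil_append, List.append_nil]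

theorem filter_range_not_Icc {n k m : ℕ} (hkm : k ≤ m) (hm : m < n) :
    (List.range n).filter (fun x => ¬(k ≤ x ∧ x ≤ m)) =
      List.range k ++ List.range' (m + 1) (n - (m + 1)) := by
  have h1 : (List.range k).filter (fun x => ¬(k ≤ x ∧ x ≤ m)) = List.range k := by
    simp only [List.filter_eq_self, List.mem_range, decide_eq_true_eq]
    omega
  have h2 : (List.range' k (m - k + 1)).filter (fun x => ¬(k ≤ x ∧ x ≤ m)) = [] := by
    simp only [List.filter_eq_nil_iff, List.mem_range'_1, decide_eq_true_eq]
    omega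
  have h3 : (List.range' (m + 1) (n - (m + 1))).filter (fun x => ¬(k ≤ x ∧ x ≤ m)) =
      List.range' (m + 1) (n - (m + 1)) := by
    simp only [List.filter_eq_self, List.mem_range'_1, decide_eq_true_eq]
    omega
  rw [range_eq_append_of_le hkm hm, List.filter_append, List.filter_append, h1, h2, h3,
    List.nil_append]

theorem Represents.insertTerm (hF : Represents ι X F f) (hG : Represents ι X G g)
    (i : Fin n → Fin r) (b : Fin n → 𝔅) (k m : Fin n) (hkm : k ≤ m) :
    insertTerm F G i k m b =
      insertWord ι f g ((List.range k).map (extendFin fun k => ι (b k) * X (i k)))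
        ((List.range' k (m - k + 1)).map (extendFin fun k => ι (b k) * X (i k)))
        ((List.range' (m + 1) (n - (m + 1))).map (extendFin fun k => ι (b k) * X (i k))) := by
  set y : Fin n → A := fun k => ι (b k) * X (i k) with hy
  have hblock : OpMonotone.onBlock G i (Finset.Icc k m) b =
      g ((List.range' k (m - k + 1)).map (extendFin y)) := by
    rw [hG.onBlock i b _ (fun x => k ≤ x ∧ x ≤ m), filter_range_Icc hkm m.is_lt]
    intro x
    simp
  unfold OpMonotone.insertTerm
  rw [hF, hblock]
  set w := (List.range' k (m - k + 1)).map (extendFin y)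
  have hz : ∀ a : Fin (Finset.Icc k m)ᶜ.card,
      ι (if ((Finset.Icc k m)ᶜ.orderEmbOfFin rfl a : ℕ) = m + 1
        then g w * b ((Finset.Icc k m)ᶜ.orderEmbOfFin rfl a)
        else b ((Finset.Icc k m)ᶜ.orderEmbOfFin rfl a)) *
          X (i ((Finset.Icc k m)ᶜ.orderEmbOfFin rfl a)) =
      (fun v : Fin n => if (v : ℕ) = m + 1 then ι (g w) * y v else y v)
        ((Finset.Icc k m)ᶜ.orderEmbOfFin rfl a) := fun a => by
    split_ifs with h
    · simp only [h, if_true, map_mul, mul_assoc, hy]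
    · simp only [h, if_false, hy]
  simp only [hz]
  rw [ofFn_orderEmbOfFin (Finset.Icc k m)ᶜ
      fun v : Fin n => if (v : ℕ) = m + 1 then ι (g w) * y v else y v,
    map_filter_finRange _ (fun v => if v = m + 1 then ι (g w) * extendFin y v else extendFin y v)
      (fun v => by rw [extendFin_val]) _ (fun x => ¬(k ≤ x ∧ x ≤ m)) (fun x => by simp),
    filter_range_not_Icc hkm m.is_lt, List.map_append]
  have h1 : (List.range k).map
      (fun v : ℕ => if v = m + 1 then ι (g w) * extendFin y v else extendFin y v) =
      (List.range k).map (extendFin y) := List.map_congr_left fun v hv => by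
    have h := List.mem_range.mp hv
    have h' : (k : ℕ) ≤ m := hkm
    rw [if_neg (by omega)]
  rw [h1]
  -- If the block ends the word its value multiplies from the right; otherwise position `m + 1` is
  -- the head of the remaining letters and absorbs it.
  by_cases hm : (m : ℕ) + 1 = n
  · simp [hm, insertWord]
  · obtain ⟨d, hd⟩ := Nat.exists_eq_add_of_lt (show (m : ℕ) + 1 < n by have := m.2; omega)
    have h2 : n - (m + 1) = d + 1 := by omega
    rw [h2, List.range'_succ, List.map_cons, List.map_cons, insertWord, if_neg hm, mul_one,
      if_pos rfl]
    congr 3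
    refine List.map_congr_left fun v hv => ?_
    have h := (List.mem_range'_1.mp hv).1
    rw [if_neg (by omega)]

/-- The condition `g [] = 0` is what reconciles the constant component `F_∅ G_∅` with the empty sum
of `insertFrom` on the empty word. -/
theorem Represents.insertProd (hF : Represents ι X F f) (hG : Represents ι X G g)
    (h0 : g [] = 0) : Represents ι X (insertProd F G) (insertFrom ι f g []) := by
  rintro (_ | n) i b
  · simp only [OpMonotone.insertProd, MultilinearMap.constOfIsEmpty_apply, hG 0]
    simp [h0, insertFrom]
  have h : OpMonotone.insertProd F G (n + 1) i b =
      ∑ v : Fin (n + 1) × Fin (n + 1) with v.1 ≤ v.2, OpMonotone.insertTerm F G i v.1 v.2 b := by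
    unfold OpMonotone.insertProd
    rw [_root_.sum_apply]
    rfl
  rw [h, insertFrom_eq_sum, ← map_extendFin_range, Finset.sum_sigma']
  simp only [List.length_map, List.length_range]
  refine Finset.sum_bij' (fun v _ => ⟨(v.1 : ℕ), (v.2 : ℕ) - v.1⟩)
    (fun s hs => (⟨s.1, ?_⟩, ⟨s.1 + s.2, ?_⟩)) ?_ ?_ ?_ ?_ ?_
  · simp only [Finset.mem_sigma, Finset.mem_range] at hs
    omega
  · simp only [Finset.mem_sigma, Finset.mem_range] at hs
    omega
  · rintro ⟨k, m⟩ hv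
    simp only [Finset.mem_filter, Finset.mem_univ, true_and, Fin.le_def] at hv
    simp only [Finset.mem_sigma, Finset.mem_range]
    omega
  · rintro ⟨k, j⟩ hs
    simp only [Finset.mem_filter, Finset.mem_univ, true_and, Fin.le_def]
    omega
  · rintro ⟨k, m⟩ hv
    simp only [Finset.mem_filter, Finset.mem_univ, true_and, Fin.le_def] at hv
    simp only [Prod.mk.injEq, Fin.ext_iff, true_and]
    omega
  · rintro ⟨k, j⟩ hs
    simp
  · rintro ⟨k, m⟩ hv
    simp only [Finset.mem_filter, Finset.mem_univ, true_and] at hv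
    have hv' : (k : ℕ) ≤ m := hv
    have hm := m.is_lt
    have h1 : (List.range (n + 1)).take k = List.range k := by
      rw [List.take_range, min_eq_left (by omega)]
    have h2 : ((List.range (n + 1)).drop k).take (m - k + 1) = List.range' k (m - k + 1) := by
      rw [List.range_eq_range', List.drop_range', List.take_range'_of_length_ge (by omega)]
      simp
    have h3 : (List.range (n + 1)).drop (k + (m - k + 1)) =
        List.range' (m + 1) (n + 1 - (m + 1)) := by
      rw [List.range_eq_range', List.drop_range', show (k : ℕ) + (m - k + 1) = m + 1 by omega]
      simp
    rw [hF.insertTerm hG i b k m hv, ← List.map_take, ← List.map_drop, ← List.map_take,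
      ← List.map_drop, List.nil_append, h1, h2, h3]

end Bridge

/-! ## Monotone independence of words in the copies -/

section Moments

variable {𝕜 𝔅 A A' : Type*} [Field 𝕜] [Ring 𝔅] [Algebra 𝕜 𝔅] [Ring A] [Algebra 𝕜 A]
  [Ring A'] [Algebra 𝕜 A'] {P : ProbSpace 𝕜 𝔅 A} {P' : ProbSpace 𝕜 𝔅 A'}

namespace MonotoneCopies

variable (D : MonotoneCopies P P')

/-- The product of the letters `x⁽ʲ⁾` of a word in pairs `(j, x)`. -/
def wordProd (w : List (ℕ × A)) : A' := (w.map fun q => D.copy q.1 q.2).prod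

theorem wordProd_nil : D.wordProd [] = 1 := rfl

theorem wordProd_cons (q : ℕ × A) (w : List (ℕ × A)) :
    D.wordProd (q :: w) = D.copy q.1 q.2 * D.wordProd w := by
  simp [wordProd]

theorem wordProd_append (u w : List (ℕ × A)) :
    D.wordProd (u ++ w) = D.wordProd u * D.wordProd w := by
  simp [wordProd]

theorem copy_incl_mul (j : ℕ) (b : 𝔅) (x : A) :
    D.copy j (P.incl b * x) = P'.incl b * D.copy j x := by
  simpa using D.copy_bimodule j b x 1

theorem copy_mul_incl (j : ℕ) (b : 𝔅) (x : A) :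
    D.copy j (x * P.incl b) = D.copy j x * P'.incl b := by
  simpa using D.copy_bimodule j 1 x b

theorem E_copy (j : ℕ) (x : A) : P'.E (D.copy j x) = P.E x := by
  simpa using D.copy_distrib j 1 (fun _ => x) le_rfl

/-- A letter whose index exceeds those of its neighbours may be replaced by its expectation. -/
theorem E_wordProd_replace (u v : List (ℕ × A)) (j : ℕ) (x : A)
    (hu : ∀ q ∈ u.getLast?, q.1 < j) (hv : ∀ q ∈ v.head?, q.1 < j) :
    P'.E (D.wordProd u * D.copy j x * D.wordProd v) =
      P'.E (D.wordProd u * P'.incl (P.E x) * D.wordProd v) := by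
  set w := u ++ (j, x) :: v with hw
  have hp : u.length < w.length := by simp [hw]
  have hwp : w[u.length] = (j, x) := by simp [hw]
  have h := D.copy_indep w.length (fun k => (w[k]).1) (fun k => D.copy (w[k]).1 (w[k]).2)
    (fun k => ⟨_, rfl⟩) ⟨u.length, hp⟩ (by
      rintro ⟨k, hk⟩ (h | h)
      · simp only at h
        have hk' : k < u.length := by omega
        simp only [Fin.getElem_fin, hwp]
        have h1 : w[k] = u[k] := by simp [hw, hk']
        rw [h1]
        apply hu
        rw [List.getLast?_eq_getElem?, ← h]
        simp
      · simp only at h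
        subst h
        simp only [Fin.getElem_fin, hwp]
        have hv0 : 0 < v.length := by
          simp only [hw, List.length_append, List.length_cons] at hk
          omega
        have h1 : w[u.length + 1] = v[0] := by simp [hw]
        rw [h1]
        apply hv
        rw [List.head?_eq_getElem?]
        simp)
  have hset : ∀ z : A', List.ofFn (Function.update
      (fun k : Fin w.length => D.copy (w[k]).1 (w[k]).2) ⟨u.length, hp⟩ z) =
      (u.map fun q => D.copy q.1 q.2) ++ z :: (v.map fun q => D.copy q.1 q.2) := by
    intro z
    have : (u.map fun q => D.copy q.1 q.2) ++ z :: (v.map fun q => D.copy q.1 q.2) =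
        (w.map fun q => D.copy q.1 q.2).set u.length z := by
      simp [hw]
    rw [this]
    refine List.ext_getElem (by simp) fun k h1 h2 => ?_
    simp [List.getElem_set, Function.update_apply, Fin.ext_iff, eq_comm]
  rw [hset] at h
  have h1 := List.ofFn_getElem_eq_map w fun q => D.copy q.1 q.2
  simp only [Fin.getElem_fin] at h
  rw [h1] at h
  simp only [hwp, E_copy] at h
  simpa [hw, wordProd, mul_assoc] using h

/-- The word with all indices increased by `N`. -/
def shiftWord (N : ℕ) (w : List (ℕ × A)) : List (ℕ × A) := w.map fun q => (N + q.1, q.2)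

/-- Choosing the leftmost maximum makes the left neighbour strictly smaller, so that only the right
neighbour can have the same index. -/
theorem exists_leftmost_max {α : Type*} (w : List (ℕ × α)) (hw : w ≠ []) :
    ∃ u j x v, w = u ++ (j, x) :: v ∧ (∀ q ∈ u, q.1 < j) ∧ ∀ q ∈ v, q.1 ≤ j := by
  induction w with
  | nil => exact absurd rfl hw
  | cons p w ih =>
    obtain ⟨k, y⟩ := p
    rcases eq_or_ne w [] with rfl | hw'
    · exact ⟨[], k, y, [], rfl, by simp, by simp⟩
    · obtain ⟨u, j, x, v, rfl, hu, hv⟩ := ih hw'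
      rcases lt_or_ge k j with h | h
      · exact ⟨(k, y) :: u, j, x, v, rfl, by simpa [h] using hu, hv⟩
      · refine ⟨[], k, y, u ++ (j, x) :: v, rfl, by simp, ?_⟩
        intro q hq
        simp only [List.mem_append, List.mem_cons] at hq
        rcases hq with hq | rfl | hq
        · exact (hu q hq).le.trans h
        · exact h
        · exact (hv q hq).trans h

/-- A block of letters with large indices between letters with small indices may be replaced by its
expectation, which does not change if all indices in the block are shifted. -/
theorem E_wordProd_block (N : ℕ) (w u v : List (ℕ × A)) (hu : ∀ q ∈ u.getLast?, q.1 < N)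
    (hv : ∀ q ∈ v.head?, q.1 < N) :
    P'.E (D.wordProd u * D.wordProd (shiftWord N w) * D.wordProd v) =
      P'.E (D.wordProd u * P'.incl (P'.E (D.wordProd w)) * D.wordProd v) := by
  induction hn : w.length using Nat.strong_induction_on generalizing w with
  | _ n ih =>
  -- it suffices to find a shorter word with the same moments
  have key : ∀ w' : List (ℕ × A), w'.length < n →
      P'.E (D.wordProd u * D.wordProd (shiftWord N w) * D.wordProd v) =
        P'.E (D.wordProd u * D.wordProd (shiftWord N w') * D.wordProd v) →
      P'.E (D.wordProd w) = P'.E (D.wordProd w') →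
      P'.E (D.wordProd u * D.wordProd (shiftWord N w) * D.wordProd v) =
      P'.E (D.wordProd u * P'.incl (P'.E (D.wordProd w)) * D.wordProd v) :=
    fun w' hl h1 h2 => by rw [h1, h2, ih _ hl w' rfl]
  rcases eq_or_ne w [] with rfl | hw
  · have h1 : P'.E 1 = 1 := by simpa using P'.E_incl 1
    simp [shiftWord, wordProd_nil, h1]
  obtain ⟨a, j, x, c, rfl, ha, hc⟩ := exists_leftmost_max w hw
  -- Two adjacent letters of the same copy merge, since `copy j` is multiplicative, and the word
  -- gets shorter.
  by_cases hcj : ∃ c' y, c = (j, y) :: c'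
  · obtain ⟨c', y, rfl⟩ := hcj
    refine key (a ++ (j, x * y) :: c') (by simp [← hn]) ?_ ?_
    · simp [shiftWord, wordProd_append, wordProd_cons, mul_assoc]
    · simp [wordProd_append, wordProd_cons, mul_assoc]
  have hc' : ∀ q ∈ c.head?, q.1 < j := by
    rintro ⟨k, y⟩ hq
    obtain ⟨c', rfl⟩ : ∃ c', c = (k, y) :: c' := by
      cases c with
      | nil => simp at hq
      | cons z c' => simp at hq; exact ⟨c', by rw [hq]⟩
    have := hc (k, y) (by simp)
    rcases this.lt_or_eq with h | h
    · exact h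
    · exact absurd ⟨c', y, by simp at h; rw [h]⟩ hcj
  have hlow : P'.E (D.wordProd (a ++ (j, x) :: c)) =
      P'.E (D.wordProd a * P'.incl (P.E x) * D.wordProd c) := by
    rw [← D.E_wordProd_replace a c j x (fun q hq => ha q (List.mem_of_getLast? hq)) hc',
      wordProd_append, wordProd_cons, mul_assoc]
  have hhigh : P'.E (D.wordProd u * D.wordProd (shiftWord N (a ++ (j, x) :: c)) * D.wordProd v) =
      P'.E (D.wordProd u * (D.wordProd (shiftWord N a) * P'.incl (P.E x) *
        D.wordProd (shiftWord N c)) * D.wordProd v) := by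
    -- Inside the longer word the letter is still a strict local maximum: neighbours within the
    -- block are shifted equally, and those in `u` or `v` have index below `N`.
    have h := D.E_wordProd_replace (u ++ shiftWord N a) (shiftWord N c ++ v) (N + j) x ?_ ?_
    · simpa only [shiftWord, List.map_append, List.map_cons, wordProd_append, wordProd_cons,
        mul_assoc] using h
    · intro q hq
      rcases List.eq_nil_or_concat a with rfl | ⟨a', z, rfl⟩
      · simp only [shiftWord, List.map_nil, List.append_nil] at hq
        exact (hu q hq).trans_le (Nat.le_add_right N j)
      · simp [shiftWord] at hq
        have := ha z (by simp)
        rw [← hq]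
        simpa using this
    · intro q hq
      rcases c with _ | ⟨z, c'⟩
      · simp only [shiftWord, List.map_nil, List.nil_append] at hq
        exact (hv q hq).trans_le (Nat.le_add_right N j)
      · simp [shiftWord] at hq
        have := hc' z (by simp)
        rw [← hq]
        simpa using this
  -- The scalar `P.E x` need not lie in any copy, so it must be absorbed into a neighbouring letter
  -- of the block: the right one if it exists, else the left one. With no neighbour, the block is
  -- already a scalar.
  rcases c with _ | ⟨⟨k, y⟩, c'⟩
  · rcases List.eq_nil_or_concat a with rfl | ⟨a', ⟨k, y⟩, rfl⟩
    · rw [hlow, hhigh]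
      simp [shiftWord, wordProd_nil, P'.E_incl]
    · refine key (a' ++ [(k, y * P.incl (P.E x))]) (by simp [← hn]) ?_ ?_
      · rw [hhigh]
        simp [shiftWord, wordProd_append, wordProd_cons, wordProd_nil, copy_mul_incl, mul_assoc]
      · rw [hlow]
        simp [wordProd_append, wordProd_cons, wordProd_nil, copy_mul_incl, mul_assoc]
  · refine key (a ++ (k, P.incl (P.E x) * y) :: c') (by simp [← hn]) ?_ ?_
    · rw [hhigh]
      simp [shiftWord, wordProd_append, wordProd_cons, copy_incl_mul, mul_assoc]
    · rw [hlow]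
      simp [wordProd_append, wordProd_cons, copy_incl_mul, mul_assoc]

/-! ### The semigroup law of the dot operation -/

/-- Two linear functionals that are related on words are related on products of sums of letters. -/
theorem prod_sum_ext {α M : Type*} [AddCommGroup M] (s : Finset ℕ) (c d : ℕ → α → A') (l : List α)
    (Φ Ψ : A' →+ M)
    (h : ∀ w : List (ℕ × α), (∀ q ∈ w, q.1 ∈ s) → w.map Prod.snd = l →
      Φ (w.map fun q => c q.1 q.2).prod = Ψ (w.map fun q => d q.1 q.2).prod) :
    Φ (l.map fun x => ∑ j ∈ s, c j x).prod = Ψ (l.map fun x => ∑ j ∈ s, d j x).prod := by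
  induction l generalizing Φ Ψ with
  | nil => simpa using h [] (by simp) rfl
  | cons x l ih =>
    simp only [List.map_cons, List.prod_cons, Finset.sum_mul, map_sum]
    refine Finset.sum_congr rfl fun j hj => ?_
    refine ih (Φ.comp (AddMonoidHom.mulLeft (c j x))) (Ψ.comp (AddMonoidHom.mulLeft (d j x)))
      fun w hw hl => ?_
    have := h ((j, x) :: w) (by simpa [hj] using fun a b => hw (a, b)) (by simp [hl])
    simpa using this

/-- `φ'((N.x₁) ⋯ (N.xₙ))` as a function of the word `x₁ ⋯ xₙ`. -/
def dotMoment (N : ℕ) (l : List A) : 𝔅 := P'.E (l.map (D.dot N)).prod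

theorem dot_incl_mul (N : ℕ) (b : 𝔅) (x : A) : D.dot N (P.incl b * x) = P'.incl b * D.dot N x := by
  simp only [dot, copy_incl_mul, Finset.mul_sum]

theorem dot_add_eq (N M : ℕ) (x : A) :
    D.dot (N + M) x = D.dot N x + ∑ j ∈ Finset.range M, D.copy (N + j) x :=
  Finset.sum_range_add _ _ _

/-- The block property for sums of copies, with an arbitrary right factor that does not start with
a large letter. -/
theorem E_dot_block (N M : ℕ) (p c : List A) (v : List (ℕ × A)) (hv : ∀ q ∈ v.head?, q.1 < N) :
    P'.E ((p.map (D.dot N)).prod * (c.map fun x => ∑ j ∈ Finset.range M, D.copy (N + j) x).prod *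
        D.wordProd v) =
      P'.E ((p.map (D.dot N)).prod * P'.incl (D.dotMoment M c) * D.wordProd v) := by
  refine prod_sum_ext (Finset.range N) (fun j x => D.copy j x) (fun j x => D.copy j x) p
    (P'.E.toAddMonoidHom.comp ((AddMonoidHom.mulRight (D.wordProd v)).comp (AddMonoidHom.mulRight
      (c.map fun x => ∑ j ∈ Finset.range M, D.copy (N + j) x).prod)))
    (P'.E.toAddMonoidHom.comp ((AddMonoidHom.mulRight (D.wordProd v)).comp (AddMonoidHom.mulRight
      (P'.incl (D.dotMoment M c))))) fun u hu _ => ?_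
  refine prod_sum_ext (Finset.range M) (fun j x => D.copy (N + j) x) (fun j x => D.copy j x) c
    (P'.E.toAddMonoidHom.comp ((AddMonoidHom.mulRight (D.wordProd v)).comp
      (AddMonoidHom.mulLeft (D.wordProd u))))
    (P'.E.toAddMonoidHom.comp ((AddMonoidHom.mulRight (D.wordProd v)).comp
      ((AddMonoidHom.mulLeft (D.wordProd u)).comp
        (P'.incl.toLinearMap.toAddMonoidHom.comp P'.E.toAddMonoidHom)))) fun w _ _ => ?_
  have h := D.E_wordProd_block N w u v
    (fun q hq => Finset.mem_range.mp (hu q (List.mem_of_getLast? hq))) hv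
  rw [shiftWord, wordProd, wordProd, List.map_map] at h
  exact h

/-- State of a left-to-right expansion: `p` holds finished small letters, `c` the current run of
large ones, `l` the unread letters. Splitting the next letter into its small and large parts either
closes the run, whose expectation the small letter absorbs, or lengthens it. -/
theorem E_prod_eq_foldSum (N M : ℕ) (p c l : List A) :
    P'.E ((p.map (D.dot N)).prod * (c.map fun x => ∑ j ∈ Finset.range M, D.copy (N + j) x).prod *
        (l.map (D.dot (N + M))).prod) =
      foldSum (fun c x => P.incl (D.dotMoment M c) * x)
        (fun p c => D.dotMoment N p * D.dotMoment M c) p c l := by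
  induction l generalizing p c with
  | nil =>
    have h := D.E_dot_block N M p c [] (by simp)
    have hb := P'.E_bimodule 1 (p.map (D.dot N)).prod (D.dotMoment M c)
    simp only [map_one, one_mul] at hb
    simp only [wordProd_nil, mul_one] at h
    simp only [foldSum, List.map_nil, List.prod_nil, mul_one]
    exact h.trans hb
  | cons x l ih =>
    rw [foldSum, ← ih, ← ih, List.map_cons, List.prod_cons, dot_add_eq, add_mul, mul_add, map_add]
    congr 1
    -- The block property needs single copies to the right of the run. The unread part is expanded
    -- into words, and the small letter in front of it supplies the required index below `N`.
    · have h := prod_sum_ext (M := 𝔅) (Finset.range (N + M)) (fun j x => D.copy j x)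
        (fun j x => D.copy j x) l
        (P'.E.toAddMonoidHom.comp (AddMonoidHom.mulLeft ((p.map (D.dot N)).prod *
          (c.map fun x => ∑ j ∈ Finset.range M, D.copy (N + j) x).prod * D.dot N x)))
        (P'.E.toAddMonoidHom.comp (AddMonoidHom.mulLeft ((p.map (D.dot N)).prod *
          P'.incl (D.dotMoment M c) * D.dot N x))) fun w _ _ => by
        have hx : D.dot N x = ∑ j ∈ Finset.range N, D.copy j x := rfl
        simp only [AddMonoidHom.comp_apply, AddMonoidHom.coe_mulLeft, LinearMap.toAddMonoidHom_coe,
          hx, mul_assoc, Finset.sum_mul, Finset.mul_sum, map_sum]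
        refine Finset.sum_congr rfl fun j hj => ?_
        have := D.E_dot_block N M p c ((j, x) :: w) (by simpa using Finset.mem_range.mp hj)
        simpa only [wordProd, List.map_cons, List.prod_cons, mul_assoc] using this
      simp only [AddMonoidHom.comp_apply, AddMonoidHom.coe_mulLeft, LinearMap.toAddMonoidHom_coe]
        at h
      simp only [List.map_append, List.map_cons, List.map_nil, List.prod_append, List.prod_cons,
        List.prod_nil, mul_one, dot_incl_mul]
      simp only [mul_assoc] at h ⊢
      exact h
    · simp only [List.map_append, List.map_cons, List.map_nil, List.prod_append, List.prod_cons,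
        List.prod_nil, mul_one, mul_assoc]

/-- The moments of the dot operation form a convolution semigroup. -/
theorem dotMoment_add (N M : ℕ) (l : List A) :
    D.dotMoment (N + M) l = listComp P.incl (D.dotMoment N) (D.dotMoment M) l := by
  have h := D.E_prod_eq_foldSum N M [] [] l
  simpa [listComp, dotMoment] using h

end MonotoneCopies

end Moments

/-! ## Differentiating the composition -/

section Derivative

variable {𝕜 𝔅 A : Type*} [Field 𝕜] [Ring 𝔅] [Algebra 𝕜 𝔅] [Ring A] [Algebra 𝕜 A]

variable (𝕜) in
/-- A function on words is linear in each letter. -/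
def SlotLinear (f : List A → 𝔅) : Prop :=
  ∀ u v : List A, ∃ L : A →ₗ[𝕜] 𝔅, ∀ x, f (u ++ x :: v) = L x

variable {ι : 𝔅 →ₐ[𝕜] A} {f k : List A → 𝔅} {g : 𝕜 → List A → 𝔅}

theorem SlotLinear.foldSum (hf : SlotLinear 𝕜 f) (act : List A → A → A) (g : List A → 𝔅)
    (u v c l : List A) : ∃ L : A →ₗ[𝕜] 𝔅, ∀ x,
      foldSum act (fun p c => f p * g c) (u ++ x :: v) c l = L x := by
  induction l generalizing v c with
  | nil =>
    obtain ⟨L, hL⟩ := hf u v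
    exact ⟨(LinearMap.mulRight 𝕜 (g c)).comp L, fun x => by simp [OpMonotone.foldSum, hL]⟩
  | cons y l ih =>
    obtain ⟨L, hL⟩ := ih (v ++ [act c y]) []
    obtain ⟨L', hL'⟩ := ih v (c ++ [y])
    exact ⟨L + L', fun x => by simp [OpMonotone.foldSum, ← hL, ← hL']⟩

/-- Isolates the scalar absorbed by the letter just selected, so that a time-dependent scalar can be
handled by `HasJet.apply` or `IsPolyFun.apply`. -/
theorem SlotLinear.foldSum_incl (hf : SlotLinear 𝕜 f) (act : List A → A → A) (g : List A → 𝔅)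
    (p c l : List A) (x : A) : ∃ L : 𝔅 →ₗ[𝕜] 𝔅, ∀ b,
      OpMonotone.foldSum act (fun p c => f p * g c) (p ++ [ι b * x]) c l = L b := by
  obtain ⟨L, hL⟩ := hf.foldSum act g p [] c l
  exact ⟨L.comp ((LinearMap.mulRight 𝕜 x).comp ι.toLinearMap), fun b => hL _⟩

theorem IsPolyFun.apply {M M' : Type*} [AddCommGroup M] [Module 𝕜 M] [AddCommGroup M']
    [Module 𝕜 M'] {f : 𝕜 → M} {g : 𝕜 → M →ₗ[𝕜] M'} (hf : IsPolyFun f)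
    (hg : ∀ m, IsPolyFun fun t => g t m) : IsPolyFun fun t => g t (f t) := by
  choose α β h using fun m => (hg m).hasJet
  obtain ⟨_, _, hf⟩ := hf.hasJet
  exact (hf.apply h).isPolyFun

/-- `f ⊙ g(t)` is polynomial in `t` if `g(t)` is. -/
theorem isPolyFun_listComp_right (hf : SlotLinear 𝕜 f) (hg : ∀ l, IsPolyFun fun t => g t l)
    (l : List A) : IsPolyFun fun t => listComp ι f (g t) l := by
  suffices h : ∀ p c, IsPolyFun fun t =>
      foldSum (fun c x => ι (g t c) * x) (fun p c => f p * g t c) p c l from h [] []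
  induction l with
  | nil => exact fun p c => (hg c).map (LinearMap.mulLeft 𝕜 (f p))
  | cons x l ih =>
    intro p c
    refine IsPolyFun.add ?_ (ih p (c ++ [x]))
    -- The time enters twice: through the scalar `g t c` and through the rest of the sum, a linear
    -- map `L t` applied to that scalar.
    choose L hL using fun t : 𝕜 =>
      hf.foldSum_incl (ι := ι) (fun c x => ι (g t c) * x) (g t) p [] l x
    simp only [hL]
    exact (hg c).apply fun b => by simpa only [← hL] using ih (p ++ [ι b * x]) []

theorem isPolyFun_insertFrom_left (hg : ∀ l, IsPolyFun fun t => g t l) (u l : List A) :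
    IsPolyFun fun t => insertFrom ι (g t) k u l := by
  have h1 : ∀ u w v, IsPolyFun fun t => insertWord ι (g t) k u w v := by
    rintro u w (_ | ⟨x, v⟩)
    · exact (hg u).map (LinearMap.mulRight 𝕜 (k w))
    · exact hg _
  have h2 : ∀ u w v, IsPolyFun fun t => insertExtend ι (g t) k u w v := by
    intro u w v
    induction v generalizing w with
    | nil => exact h1 u w []
    | cons x v ih => exact (h1 u w (x :: v)).add (ih _)
  induction l generalizing u with
  | nil => exact (HasJet.const (0 : 𝔅)).isPolyFun
  | cons x l ih => exact (ih _).add (h2 u [x] l)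

/-- The derivative of `f(t) ⊙ g` in `t`. -/
theorem hasJet_listComp_left {a b : List A → 𝔅} (hg : ∀ l, HasJet (fun t => g t l) (a l) (b l))
    (k : List A → 𝔅) (l : List A) :
    HasJet (fun t => listComp ι (g t) k l) (listComp ι a k l) (listComp ι b k l) := by
  suffices h : ∀ p c, HasJet
      (fun t => foldSum (fun c x => ι (k c) * x) (fun p c => g t p * k c) p c l)
      (foldSum (fun c x => ι (k c) * x) (fun p c => a p * k c) p c l)
      (foldSum (fun c x => ι (k c) * x) (fun p c => b p * k c) p c l) from h [] []
  induction l with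
  | nil => exact fun p c => (hg p).map (LinearMap.mulRight 𝕜 (k c))
  | cons x l ih => exact fun p c => (ih _ _).add (ih _ _)

/-- The derivative at `0` of `f ⊙ g(t)`, where `g(0)` is the unit for the composition. -/
theorem hasJet_listComp_right [CharZero 𝕜] (hf : SlotLinear 𝕜 f) (hg0 : ∀ t, g t [] = 1)
    (hg : ∀ l, l ≠ [] → HasJet (fun t => g t l) 0 (k l)) (l : List A) :
    HasJet (fun t => listComp ι f (g t) l) (f l) (insertFrom ι f k [] l) := by
  -- A pending nonempty block carries a factor vanishing at `t = 0`. It thus kills the constant term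
  -- and uses up the first order, so all other blocks must be empty; this is the dichotomy between
  -- `insertFrom` and `insertExtend`.
  suffices h : ∀ p, HasJet
      (fun t => foldSum (fun c x => ι (g t c) * x) (fun p c => f p * g t c) p [] l)
      (f (p ++ l)) (insertFrom ι f k p l) ∧ ∀ c, c ≠ [] → HasJet
      (fun t => foldSum (fun c x => ι (g t c) * x) (fun p c => f p * g t c) p c l)
      0 (insertExtend ι f k p c l) from (h []).1
  induction l with
  | nil =>
    refine fun p => ⟨?_, fun c hc => ?_⟩
    · simpa [foldSum, hg0, insertFrom] using HasJet.const (𝕜 := 𝕜) (f p)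
    · simpa [foldSum, insertExtend, insertWord] using (hg c hc).map (LinearMap.mulLeft 𝕜 (f p))
  | cons x l ih =>
    refine fun p => ⟨?_, fun c hc => ?_⟩
    · have h := (ih (p ++ [x])).1.add ((ih p).2 [x] (by simp))
      simpa [foldSum, hg0, insertFrom] using h
    · choose L hL using fun t : 𝕜 =>
        hf.foldSum_incl (ι := ι) (fun c x => ι (g t c) * x) (g t) p [] l x
      have hb : ∀ b, HasJet (fun t => L t b) (f (p ++ [ι b * x] ++ l))
          (insertFrom ι f k (p ++ [ι b * x]) l) := fun b => by
        simpa only [hL] using (ih (p ++ [ι b * x])).1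
      -- Since `L t 0 = 0`, both jet coefficients at the scalar 0 vanish; these are the terms of the
      -- product rule coming from the zero value of `g t c`.
      have h0 := (hb 0).unique (HasJet.const (0 : 𝔅)) fun N => by simp
      have h := ((hg c hc).apply hb).add ((ih p).2 (c ++ [x]) (by simp))
      rw [h0.2.1, h0.2.2, zero_add, zero_add] at h
      simpa [foldSum, hL, insertExtend, insertWord] using h

end Derivative

/-! ## Polynomiality of the moments and the cumulants -/

section Cumulants

variable {𝕜 𝔅 A A' : Type*} [Field 𝕜] [Ring 𝔅] [Algebra 𝕜 𝔅] [Ring A] [Algebra 𝕜 A]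
  [Ring A'] [Algebra 𝕜 A'] {P : ProbSpace 𝕜 𝔅 A} {P' : ProbSpace 𝕜 𝔅 A'}

theorem fwdDiff_iter_mul_const_eq_zero {R : Type*} [Ring R] {f : ℕ → R} {n : ℕ}
    (hf : (fwdDiff 1)^[n] f = 0) (b : R) :
    (fwdDiff 1)^[n] (fun N => f N * b) = 0 := by
  funext N
  have := fwdDiff_iter_comp_addMonoidHom (AddMonoidHom.mulRight b) f n N
  simpa [hf] using this

theorem fwdDiff_iter_add_eq_zero {M : Type*} [AddCommGroup M] {f g : ℕ → M} {n : ℕ}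
    (hf : (fwdDiff 1)^[n] f = 0) (hg : (fwdDiff 1)^[n] g = 0) :
    (fwdDiff 1)^[n] (fun N => f N + g N) = 0 := by
  have := fwdDiff_iter_add 1 f g n
  rw [hf, hg, add_zero] at this
  exact this

theorem fwdDiff_iter_zero {M : Type*} [AddCommGroup M] (n : ℕ) :
    (fwdDiff 1)^[n] (0 : ℕ → M) = 0 := by
  induction n with
  | zero => rfl
  | succ n ih =>
    rw [Function.iterate_succ_apply', ih]
    funext N
    simp [fwdDiff]

theorem fwdDiff_iter_eq_zero_of_le {M : Type*} [AddCommGroup M] {f : ℕ → M} {m n : ℕ} (h : m ≤ n)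
    (hf : (fwdDiff 1)^[m] f = 0) : (fwdDiff 1)^[n] f = 0 := by
  obtain ⟨k, rfl⟩ := Nat.exists_eq_add_of_le' h
  rw [Function.iterate_add_apply, hf, fwdDiff_iter_zero]

namespace MonotoneCopies

variable (D : MonotoneCopies P P')

theorem dotMoment_nil (N : ℕ) : D.dotMoment N [] = 1 := by
  simpa using! P'.E_incl 1

theorem dotMoment_zero {l : List A} (hl : l ≠ []) : D.dotMoment 0 l = 0 := by
  obtain ⟨x, l, rfl⟩ := List.exists_cons_of_ne_nil hl
  simp [dotMoment, dot]

/-- The dot operation as a linear map. -/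
def dotₗ (N : ℕ) : A →ₗ[𝕜] A' where
  toFun := D.dot N
  map_add' x y := by simp [dot, Finset.sum_add_distrib]
  map_smul' a x := by simp [dot, Finset.smul_sum]

theorem dotₗ_apply (N : ℕ) (x : A) : D.dotₗ N x = D.dot N x := rfl

theorem slotLinear_dotMoment (N : ℕ) : SlotLinear 𝕜 (D.dotMoment N) := fun u v =>
  ⟨P'.E.comp ((LinearMap.mulRight 𝕜 (v.map (D.dot N)).prod).comp
    ((LinearMap.mulLeft 𝕜 (u.map (D.dot N)).prod).comp (D.dotₗ N))), fun x => by
      simp [dotMoment, dotₗ_apply, mul_assoc]⟩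

/-- The moments `φ'((N.x₁) ⋯ (N.xₙ))` as a multilinear map. -/
def dotMomentMultilinear (N n : ℕ) : MultilinearMap 𝕜 (fun _ : Fin n => A) 𝔅 :=
  P'.E.compMultilinearMap
    ((MultilinearMap.mkPiAlgebraFin 𝕜 n A').compLinearMap fun _ => D.dotₗ N)

theorem dotMomentMultilinear_apply (N n : ℕ) (x : Fin n → A) :
    D.dotMomentMultilinear N n x = D.dotMoment N (List.ofFn x) := by
  simp [dotMomentMultilinear, dotMoment, dotₗ_apply, List.map_ofFn, Function.comp_def]

/-- By the semigroup law with one extra copy, the first difference of the moment of a word of length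
`n` is a sum of moments of shorter words times constants. Induction on length applies to these,
since the constants do not depend on `N`. -/
theorem fwdDiff_iter_dotMoment (l : List A) :
    (fwdDiff 1)^[l.length + 1] (fun N => D.dotMoment N l) = 0 := by
  induction hn : l.length using Nat.strong_induction_on generalizing l with
  | _ n ih =>
  set act : List A → A → A := fun c x => P.incl (D.dotMoment 1 c) * x with hact
  have hlow : ∀ l p c : List A, p.length + l.length < n → (fwdDiff 1)^[n]
      (fun N => foldSum act (fun p c => D.dotMoment N p * D.dotMoment 1 c) p c l) = 0 := by
    intro l
    induction l with
    | nil =>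
      intro p c h
      exact fwdDiff_iter_mul_const_eq_zero (fwdDiff_iter_eq_zero_of_le h (ih p.length h p rfl)) _
    | cons x l ihl =>
      intro p c h
      simp only [List.length_cons] at h
      exact fwdDiff_iter_add_eq_zero (ihl _ _ (by simp; omega)) (ihl _ _ (by omega))
  -- Only the choice that selects every letter retains full length. Its blocks are empty with moment
  -- 1, so it reproduces `D.dotMoment N (p ++ l)` and cancels.
  have htop : ∀ l p : List A, p.length + l.length = n → (fwdDiff 1)^[n]
      (fun N => foldSum act (fun p c => D.dotMoment N p * D.dotMoment 1 c) p [] l -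
        D.dotMoment N (p ++ l)) = 0 := by
    intro l
    induction l with
    | nil =>
      intro p _
      simpa [foldSum, dotMoment_nil] using! fwdDiff_iter_zero (M := 𝔅) n
    | cons x l ihl =>
      intro p h
      simp only [List.length_cons] at h
      have h1 := fwdDiff_iter_add_eq_zero (ihl (p ++ [x]) (by simp; omega))
        (hlow l p [x] (by omega))
      have hx : act [] x = x := by simp [hact, dotMoment_nil]
      rw [← h1]
      congr 1
      funext N
      simp only [foldSum, hx, List.append_assoc, List.cons_append, List.nil_append]
      abel
  rw [Function.iterate_succ_apply, ← htop l [] (by simpa using hn)]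
  congr 1
  funext N
  rw [fwdDiff, dotMoment_add]
  rfl

/-- Evaluation of multilinear maps as a linear map. -/
def evalMultilinear {n : ℕ} {M : Type*} [AddCommGroup M] [Module 𝕜 M] (x : Fin n → M) :
    MultilinearMap 𝕜 (fun _ : Fin n => M) 𝔅 →ₗ[𝕜] 𝔅 where
  toFun f := f x
  map_add' _ _ := rfl
  map_smul' _ _ := rfl

theorem moments_dot_apply {r : ℕ} (X : Fin r → A) (N n : ℕ) (i : Fin n → Fin r) (b : Fin n → 𝔅) :
    P'.moments (fun k => D.dot N (X k)) n i b =
      D.dotMoment N (List.ofFn fun k => P.incl (b k) * X (i k)) := by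
  simp [ProbSpace.moments, ProbSpace.mulLeftOf, dotMoment, List.map_ofFn, Function.comp_def,
    dot_incl_mul]

theorem hasJet_coeff {D : MonotoneCopies P P'} {c : List A → ℕ →₀ 𝔅}
    (hc : ∀ (l : List A) (N : ℕ), D.dotMoment N l = polyEval (c l) (N : 𝕜))
    {l : List A} (hl : l ≠ []) :
    HasJet (fun t : 𝕜 => polyEval (c l) t) 0 (c l 1) := by
  refine ⟨c l, fun t => rfl, ?_, rfl⟩
  rw [← D.dotMoment_zero hl, hc, Nat.cast_zero, polyEval_zero]

variable [CharZero 𝕜]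

/-- Interpolating in the vector space of multilinear maps makes the coefficients multilinear at
once; this yields the cumulants and the polynomial extension of the moments. -/
theorem exists_coeff_multilinear (n : ℕ) : ∃ c : ℕ →₀ MultilinearMap 𝕜 (fun _ : Fin n => A) 𝔅,
    ∀ N : ℕ, D.dotMomentMultilinear N n = polyEval c (N : 𝕜) := by
  refine exists_polyEval_of_fwdDiff_iter_eq_zero (d := n + 1) ?_
  funext N
  ext x
  have h1 := fwdDiff_iter_comp_addMonoidHom (evalMultilinear x).toAddMonoidHom (fun N => D.dotMomentMultilinear N n)
    (n + 1) N
  have h2 := D.fwdDiff_iter_dotMoment (List.ofFn x)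
  rw [List.length_ofFn] at h2
  refine h1.symm.trans ?_
  simp only [evalMultilinear, LinearMap.toAddMonoidHom_coe, LinearMap.coe_mk, AddHom.coe_mk, dotMomentMultilinear_apply, h2]
  rfl

theorem exists_coeff : ∃ c : List A → ℕ →₀ 𝔅,
    ∀ (l : List A) (N : ℕ), D.dotMoment N l = polyEval (c l) (N : 𝕜) := by
  have h : ∀ l : List A, ∃ c : ℕ →₀ 𝔅, ∀ N : ℕ, D.dotMoment N l = polyEval c (N : 𝕜) := fun l =>
    exists_polyEval_of_fwdDiff_iter_eq_zero (D.fwdDiff_iter_dotMoment l)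
  choose c hc using h
  exact ⟨c, hc⟩

/-! ### The two forms of the derivative -/

section Coefficients

variable {D} {c : List A → ℕ →₀ 𝔅}

theorem coeff_nil
    (hc : ∀ (l : List A) (N : ℕ), D.dotMoment N l = polyEval (c l) (N : 𝕜))
    : c [] = Finsupp.single 0 1 :=
  polyEval_injective_nat (𝕜 := 𝕜) fun N => by
    rw [← hc, dotMoment_nil, polyEval_single, pow_zero, one_smul]

/-- Coefficients are determined by the values at natural numbers, where linearity in a letter is
clear. -/
theorem slotLinear_coeff
    (hc : ∀ (l : List A) (N : ℕ), D.dotMoment N l = polyEval (c l) (N : 𝕜))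
    : SlotLinear 𝕜 fun l => c l 1 := by
  intro u v
  have hL : ∀ N : ℕ, ∃ L : A →ₗ[𝕜] 𝔅, ∀ x, polyEval (c (u ++ x :: v)) (N : 𝕜) = L x := fun N => by
    simpa only [← hc] using D.slotLinear_dotMoment N u v
  refine ⟨⟨⟨fun x => c (u ++ x :: v) 1, fun x y => ?_⟩, fun a x => ?_⟩, fun x => rfl⟩
  · have : c (u ++ (x + y) :: v) = c (u ++ x :: v) + c (u ++ y :: v) :=
      polyEval_injective_nat (𝕜 := 𝕜) fun N => by
        obtain ⟨L, hL⟩ := hL N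
        rw [← polyEvalₗ_apply _ (_ + _), map_add, polyEvalₗ_apply, polyEvalₗ_apply, hL, hL, hL,
          map_add]
    rw [this, Finsupp.add_apply]
  · have : c (u ++ (a • x) :: v) = a • c (u ++ x :: v) :=
      polyEval_injective_nat (𝕜 := 𝕜) fun N => by
        obtain ⟨L, hL⟩ := hL N
        rw [← polyEvalₗ_apply _ (_ • _), map_smul, polyEvalₗ_apply, hL, hL, map_smul]
    simp [this]

/-- Two jets of s ↦ m_{s+N} at 0 are compared: the Taylor one, and that of m_s ⊙ m_N. The two
functions agree at natural s by `dotMoment_add`. -/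
theorem listComp_coeff_nat
    (hc : ∀ (l : List A) (N : ℕ), D.dotMoment N l = polyEval (c l) (N : 𝕜))
    (N : ℕ) (l : List A) :
    listComp P.incl (fun l => c l 1) (D.dotMoment N) l = polyDerivEval (c l) (N : 𝕜) := by
  have h1 := HasJet.translate (c l) (N : 𝕜)
  have h2 := hasJet_listComp_left (ι := P.incl) (g := fun (t : 𝕜) l => polyEval (c l) t)
    (a := fun l => c l 0) (b := fun l => c l 1) (fun l => ⟨c l, fun t => rfl, rfl, rfl⟩)
    (D.dotMoment N) l
  refine (h2.unique h1 fun N' => ?_).2.2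
  simp only [← hc]
  rw [← Nat.cast_add, ← hc, dotMoment_add]

/-- The same comparison with the factors exchanged, m_N ⊙ m_s, where the moving factor starts at the
unit of the composition. -/
theorem insertFrom_coeff_nat
    (hc : ∀ (l : List A) (N : ℕ), D.dotMoment N l = polyEval (c l) (N : 𝕜))
    (N : ℕ) (l : List A) :
    insertFrom P.incl (D.dotMoment N) (fun l => c l 1) [] l = polyDerivEval (c l) (N : 𝕜) := by
  have h1 := HasJet.translate (c l) (N : 𝕜)
  have h2 := hasJet_listComp_right (ι := P.incl) (D.slotLinear_dotMoment N)
    (g := fun (t : 𝕜) l => polyEval (c l) t) (k := fun l => c l 1)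
    (fun t => by rw [coeff_nil hc, polyEval_single, pow_zero, one_smul])
    (fun l hl => hasJet_coeff hc hl) l
  refine (h2.unique h1 fun N' => ?_).2.2
  simp only [← hc]
  rw [← Nat.cast_add, ← hc, add_comm, dotMoment_add]

theorem listComp_coeff
    (hc : ∀ (l : List A) (N : ℕ), D.dotMoment N l = polyEval (c l) (N : 𝕜))
    (t : 𝕜) (l : List A) :
    listComp P.incl (fun l => c l 1) (fun l => polyEval (c l) t) l = polyDerivEval (c l) t := by
  refine congrFun (IsPolyFun.eq_of_nat (isPolyFun_listComp_right (slotLinear_coeff hc)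
    (g := fun (t : 𝕜) l => polyEval (c l) t) (fun l => ⟨c l, fun _ => rfl⟩) l)
    (isPolyFun_polyDerivEval (c l)) fun N => ?_) t
  simp only [← hc]
  exact listComp_coeff_nat hc N l

theorem insertFrom_coeff
    (hc : ∀ (l : List A) (N : ℕ), D.dotMoment N l = polyEval (c l) (N : 𝕜))
    (t : 𝕜) (l : List A) :
    insertFrom P.incl (fun l => polyEval (c l) t) (fun l => c l 1) [] l =
      polyDerivEval (c l) t := by
  refine congrFun (IsPolyFun.eq_of_nat (isPolyFun_insertFrom_left
    (g := fun (t : 𝕜) l => polyEval (c l) t) (fun l => ⟨c l, fun _ => rfl⟩) [] l)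
    (isPolyFun_polyDerivEval (c l)) fun N => ?_) t
  simp only [← hc]
  exact insertFrom_coeff_nat hc N l

end Coefficients

/-! ## The main theorem -/

theorem IsCumulants.apply_eq_coeff {D : MonotoneCopies P P'} {c : List A → ℕ →₀ 𝔅}
    (hc : ∀ (l : List A) (N : ℕ), D.dotMoment N l = polyEval (c l) (N : 𝕜))
    {K : (n : ℕ) → MultilinearMap 𝕜 (fun _ : Fin n => A) 𝔅} (hK : D.IsCumulants K) (n : ℕ)
    (x : Fin n → A) : K n x = c (List.ofFn x) 1 := by
  obtain ⟨d, hd, h⟩ := hK n x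
  rw [h]
  congr 1
  refine polyEval_injective_nat (𝕜 := 𝕜) fun N => ?_
  rw [← hd, ← hc, dotMoment, List.map_ofFn]
  rfl

theorem existsUnique_isCumulants :
    ∃! K : (n : ℕ) → MultilinearMap 𝕜 (fun _ : Fin n => A) 𝔅, D.IsCumulants K := by
  choose C hC using D.exists_coeff_multilinear
  refine ⟨fun n => C n 1, fun n x => ?_, fun K hK => ?_⟩
  · refine ⟨(C n).mapRange (evalMultilinear x) (map_zero _), fun N => ?_, rfl⟩
    rw [polyEval_mapRange, ← hC]
    simp [evalMultilinear, dotMomentMultilinear, dotₗ_apply]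
  · funext n
    ext x
    obtain ⟨d, hd, h⟩ := hK n x
    have : d = (C n).mapRange (evalMultilinear x) (map_zero _) :=
      polyEval_injective_nat (𝕜 := 𝕜) fun N => by
        rw [polyEval_mapRange, ← hC, ← hd]
        simp [evalMultilinear, dotMomentMultilinear, dotₗ_apply]
    rw [h, this]
    rfl

theorem existsUnique_isDotMoments {r : ℕ} (X : Fin r → A) :
    ∃! M : 𝕜 → MulSeries 𝕜 𝔅 r, D.IsDotMoments X M := by
  choose C hC using D.exists_coeff_multilinear
  refine ⟨fun t n i => (polyEval (C n) t).compLinearMap fun j => P.mulLeftOf (X (i j)),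
    ⟨fun n i => ?_, fun N => ?_⟩, fun M hM => ?_⟩
  · exact IsPolyFun.map (MultilinearMap.compLinearMapₗ fun j => P.mulLeftOf (X (i j)))
      ⟨C n, fun _ => rfl⟩
  · funext n i
    ext b
    rw [moments_dot_apply]
    dsimp only
    rw [← hC, MultilinearMap.compLinearMap_apply, dotMomentMultilinear_apply]
    rfl
  · funext t n i
    refine congrFun (IsPolyFun.eq_of_nat (hM.1 n i) (IsPolyFun.map
      (MultilinearMap.compLinearMapₗ fun j => P.mulLeftOf (X (i j))) ⟨C n, fun _ => rfl⟩)
      fun N => ?_) t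
    rw [hM.2]
    ext b
    rw [moments_dot_apply, ← hC]
    exact (D.dotMomentMultilinear_apply N n _).symm

end MonotoneCopies

end Cumulants

end OpMonotone

end

theorem mainTheorem3 {𝕜 𝔅 A A' : Type*} [Field 𝕜] [CharZero 𝕜] [Ring 𝔅] [Algebra 𝕜 𝔅]
    [Ring A] [Algebra 𝕜 A] [Ring A'] [Algebra 𝕜 A']
    (P : OpMonotone.ProbSpace 𝕜 𝔅 A) (P' : OpMonotone.ProbSpace 𝕜 𝔅 A')
    (D : OpMonotone.MonotoneCopies P P') {r : ℕ} (X : Fin r → A) :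
    (∃! K : (n : ℕ) → MultilinearMap 𝕜 (fun _ : Fin n => A) 𝔅, D.IsCumulants K) ∧
    (∃! M : 𝕜 → OpMonotone.MulSeries 𝕜 𝔅 r, D.IsDotMoments X M) ∧
    ∀ (K : (n : ℕ) → MultilinearMap 𝕜 (fun _ : Fin n => A) 𝔅) (M : 𝕜 → OpMonotone.MulSeries 𝕜 𝔅 r),
      D.IsCumulants K → D.IsDotMoments X M →
        OpMonotone.HasSeriesDeriv M (fun t => OpMonotone.comp (P.cumulantSeries K X) (M t)) ∧
        ∀ t : 𝕜, OpMonotone.comp (P.cumulantSeries K X) (M t) =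
          OpMonotone.insertProd (M t) (P.cumulantSeries K X) := by
  refine ⟨D.existsUnique_isCumulants, D.existsUnique_isDotMoments X, fun K M hK hM => ?_⟩
  obtain ⟨c, hc⟩ := D.exists_coeff
  have hκ : OpMonotone.Represents P.incl X (P.cumulantSeries K X) fun l => c l 1 := by
    rintro (_ | n) i b
    · simp [OpMonotone.ProbSpace.cumulantSeries, OpMonotone.MonotoneCopies.coeff_nil hc]
    · exact hK.apply_eq_coeff hc (n + 1) _
  -- The polynomial extension `M` and the word polynomials `c` interpolate the same moments at
  -- natural numbers, so their coefficients coincide after evaluation at `b`; this also transfers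
  -- the derivative.
  have hcoeff : ∀ (n : ℕ) (i : Fin n → Fin r) (b : Fin n → 𝔅)
      (d : ℕ →₀ MultilinearMap 𝕜 (fun _ : Fin n => 𝔅) 𝔅), (∀ t, M t n i = OpMonotone.polyEval d t) →
      d.mapRange (OpMonotone.MonotoneCopies.evalMultilinear b) (map_zero _) =
        c (List.ofFn fun k => P.incl (b k) * X (i k)) := fun n i b d hd =>
    OpMonotone.polyEval_injective_nat (𝕜 := 𝕜) fun N => by
      rw [OpMonotone.polyEval_mapRange, ← hd, ← hc, ← D.moments_dot_apply, hM.2]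
      rfl
  have hμ : ∀ t, OpMonotone.Represents P.incl X (M t) fun l => OpMonotone.polyEval (c l) t := by
    intro t n i b
    obtain ⟨d, hd⟩ := hM.1 n i
    refine (congrArg (fun f => f b) (hd t)).trans ?_
    dsimp only
    rw [← hcoeff n i b d hd, OpMonotone.polyEval_mapRange]
    rfl
  refine ⟨fun n i => ?_, fun t => ?_⟩
  · obtain ⟨d, hd⟩ := hM.1 n i
    refine ⟨d, hd, fun t => ?_⟩
    ext b
    rw [hκ.comp (hμ t), OpMonotone.MonotoneCopies.listComp_coeff hc, ← hcoeff n i b d hd,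
      OpMonotone.polyDerivEval_mapRange]
    rfl
  · funext n i
    ext b
    rw [hκ.comp (hμ t), (hμ t).insertProd hκ (by simp [OpMonotone.MonotoneCopies.coeff_nil hc]),
      OpMonotone.MonotoneCopies.listComp_coeff hc, OpMonotone.MonotoneCopies.insertFrom_coeff hc]
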